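/- For integers $n\ge 0$, $A,p\ge 1$, let $(k)_{n+1}=k(k+1)\cdots(k+n)$, let $H_N=\sum_{k=1}^N \frac1k$, and let $\mathscr{A}_p$ be the set of polynomials $P\in\mathbb{Q}[X_1,\ldots,X_p]$ such that $$P(X_{\sigma(1)},\ldots,X_{\sigma(p)})=\varepsilon_\sigma P(X_1,\ldots,X_p)\quad\text{for all }\sigma\in\mathfrak{S}_p,$$ $$P(X_1,\ldots,X_{j-1},-X_j-n,X_{j+1},\ldots,X_p)=(-1)^{A(n+1)+1}P(X_1,\ldots,X_p)\quad\text{for all }j\in\{1,\ldots,p\},$$ where $\varepsilon_\sigma$ is the signature of $\sigma$. For $r\ge 0$ and integers $s_1,\ldots,s_r\ge 1$, let $\zeta_*(s_1,\ldots,s_r)$ be the regularized multiple zeta value, i.e. $Q(0)$ where $Q\in\mathbb{R}[X]$ is the unique polynomial such that, for every $\varepsilon>0$, as $N\to+\infty$, $$\sum_{N\ge k_1>\cdots>k_r\ge 1}\frac{1}{k_1^{s_1}\cdots k_r^{s_r}}=Q(H_N)+\mathcal{O}_\varepsilon(N^{-1+\varepsilon}),$$ and let $\zeta_*^{\mathrm{as}}(s_1,\ldots,s_r)=\sum_{\sigma\in\mathfrak{S}_r}\varepsilon_\sigma\,\zeta_*(s_{\sigma(1)},\ldots,s_{\sigma(r)})$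 (equal to $1$ when $r=0$). **Theorem.** Let $n\ge 0$ be even, let $A,p\ge 1$ be integers, and let $P\in\mathscr{A}_p$ be of degree $\le A(n+1)-1$ with respect to each of the variables. Then there exists a polynomial $Q_P\in\mathbb{R}[X]$ such that, for every $\varepsilon>0$, as $N\to+\infty$, $$\sum_{N\ge k_1\ge\cdots\ge k_p\ge 1}\frac{P(k_1,\ldots,k_p)}{(k_1)_{n+1}^A\cdots(k_p)_{n+1}^A}=Q_P(H_N)+\mathcal{O}_\varepsilon(N^{-1+\varepsilon}),$$ and such that $Q_P(0)$ is a linear combination, with rational coefficients, of products of the form $$\zeta_*(s_1)\cdots\zeta_*(s_q)\,\zeta_*^{\mathrm{as}}(s'_1,\ldots,s'_{q'})$$ with integers $q,q'\ge 0$ such that $2q+q'\le p$, with $s_1,\ldots,s_q,s'_1,\ldots,s'_{q'}$ odd integers $\ge 1$, $s_i\le 2A-1$ for all $i\in\{1,\ldots,q\}$ and $s'_i\le A$ for all $i\in\{1,\ldots,q'\}$. -/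

import Mathlib

/-- `Q` gives the asymptotic expansion of `u` in terms of harmonic numbers: for every `ε > 0`,
`u N = Q (H_N) + O_ε (N ^ (-1 + ε))` as `N → ∞`. -/
def IsHarmonicExpansion (u : ℕ → ℝ) (Q : Polynomial ℝ) : Prop :=
  ∀ ε : ℝ, 0 < ε →
    (fun N : ℕ => u N - Q.eval (harmonic N : ℝ)) =O[Filter.atTop]
      fun N : ℕ => (N : ℝ) ^ (-1 + ε)

/-- The polynomial in a harmonic expansion is unique. -/
theorem IsHarmonicExpansion.unique {u : ℕ → ℝ} {Q₁ Q₂ : Polynomial ℝ}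
    (h₁ : IsHarmonicExpansion u Q₁) (h₂ : IsHarmonicExpansion u Q₂) : Q₁ = Q₂ := by
  have hH : Filter.Tendsto (fun N : ℕ => (harmonic N : ℝ)) Filter.atTop Filter.atTop := by
    refine Filter.tendsto_atTop_mono (fun N => log_add_one_le_harmonic N) ?_
    exact Real.tendsto_log_atTop.comp
      (tendsto_natCast_atTop_atTop.comp (Filter.tendsto_add_atTop_nat 1))
  have hO : Filter.Tendsto (fun N : ℕ => (Q₁ - Q₂).eval (harmonic N : ℝ)) Filter.atTop
      (nhds 0) := by
    have h := (h₂ (1 / 2) (by norm_num)).sub (h₁ (1 / 2) (by norm_num))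
    have h0 : Filter.Tendsto (fun N : ℕ => (N : ℝ) ^ (-1 + 1 / 2 : ℝ)) Filter.atTop (nhds 0) := by
      have := (tendsto_rpow_neg_atTop (y := 1 / 2) (by norm_num)).comp
        (tendsto_natCast_atTop_atTop (R := ℝ))
      refine this.congr fun N => ?_
      norm_num
    refine (h.trans_tendsto h0).congr fun N => ?_
    simp
  rw [← sub_eq_zero]
  rcases le_or_gt (Q₁ - Q₂).degree 0 with hd | hd
  · rw [Polynomial.eq_C_of_degree_le_zero hd] at hO ⊢
    simp only [Polynomial.eval_C, tendsto_const_nhds_iff] at hO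
    rw [hO, Polynomial.C_0]
  · exact absurd hO.abs (not_tendsto_nhds_of_tendsto_atTop
      ((Polynomial.abs_tendsto_atTop _ hd).comp hH) _)

/-- The strict truncated multiple harmonic sum
`∑_{N ≥ k₁ > ⋯ > k_p ≥ 1} 1 / (k₁ ^ s₁ ⋯ k_p ^ s_p)`. -/
noncomputable def truncatedMZV {p : ℕ} (s : Fin p → ℕ) (N : ℕ) : ℝ :=
  ∑ k ∈ (Fintype.piFinset fun _ : Fin p => Finset.Icc 1 N).filter
      (fun k => ∀ i j, i < j → k j < k i),
    ∏ i, 1 / (k i : ℝ) ^ s i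

open Classical in
/-- The (stuffle-)regularized multiple zeta value `ζ_*(s₁, …, s_p)`: the constant coefficient of
the unique polynomial `Q` such that, for every `ε > 0`,
`∑_{N ≥ k₁ > ⋯ > k_p ≥ 1} 1 / (k₁ ^ s₁ ⋯ k_p ^ s_p) = Q (H_N) + O_ε (N ^ (-1 + ε))`.
Such a polynomial exists whenever all `s_i ≥ 1`; the value `0` is a placeholder otherwise. -/
noncomputable def regMZV {p : ℕ} (s : Fin p → ℕ) : ℝ :=
  if h : ∃ Q : Polynomial ℝ, IsHarmonicExpansion (truncatedMZV s) Q then h.choose.eval 0 else 0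

theorem regMZV_eq {p : ℕ} {s : Fin p → ℕ} {Q : Polynomial ℝ}
    (hQ : IsHarmonicExpansion (truncatedMZV s) Q) : regMZV s = Q.eval 0 := by
  have h : ∃ Q : Polynomial ℝ, IsHarmonicExpansion (truncatedMZV s) Q := ⟨Q, hQ⟩
  rw [regMZV, dif_pos h, h.choose_spec.unique hQ]

/-- The regularized antisymmetric multiple zeta value
`ζ_*^as(s₁, …, s_p) = ∑_{σ ∈ 𝔖_p} ε_σ ζ_*(s_{σ(1)}, …, s_{σ(p)})`. -/
noncomputable def regAntisymMZV {p : ℕ} (s : Fin p → ℕ) : ℝ :=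
  ∑ σ : Equiv.Perm (Fin p), ((Equiv.Perm.sign σ : ℤ) : ℝ) * regMZV (s ∘ σ)

/-- The set `𝒜_p` (for given `n` and `A`) of the polynomials `P ∈ ℚ[X₁, …, X_p]` such that
`P(X_{σ(1)}, …, X_{σ(p)}) = ε_σ P(X₁, …, X_p)` for every permutation `σ` and
`P(…, -X_j - n, …) = (-1) ^ (A (n + 1) + 1) P(…, X_j, …)` for every `j`. -/
def symmetryClass (n A p : ℕ) : Set (MvPolynomial (Fin p) ℚ) :=
  {P | (∀ σ : Equiv.Perm (Fin p),
          MvPolynomial.rename σ P = MvPolynomial.C ((Equiv.Perm.sign σ : ℤ) : ℚ) * P) ∧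
       ∀ j : Fin p,
          MvPolynomial.bind₁ (Function.update (MvPolynomial.X : Fin p → MvPolynomial (Fin p) ℚ) j
            (-MvPolynomial.X j - MvPolynomial.C (n : ℚ))) P = (-1) ^ (A * (n + 1) + 1) * P}

/-- The truncated ordered sum
`∑_{N ≥ k₁ ≥ ⋯ ≥ k_p ≥ 1} P(k₁, …, k_p) / ((k₁)_{n+1} ^ A ⋯ (k_p)_{n+1} ^ A)`, where
`(k)_{n+1} = k (k + 1) ⋯ (k + n)` is the Pochhammer symbol. -/
noncomputable def truncatedHypergeometricSum (n A : ℕ) {p : ℕ} (P : MvPolynomial (Fin p) ℚ)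
    (N : ℕ) : ℝ :=
  ∑ k ∈ (Fintype.piFinset fun _ : Fin p => Finset.Icc 1 N).filter
      (fun k => ∀ i j, i ≤ j → k j ≤ k i),
    MvPolynomial.aeval (fun i => (k i : ℝ)) P /
      ∏ i, (ascPochhammer ℝ (n + 1)).eval (k i : ℝ) ^ A

/-- The products `ζ_*(s₁) ⋯ ζ_*(s_q) ζ_*^as(s'₁, …, s'_{q'})` with `q, q' ≥ 0`, `2q + q' ≤ p`,
all `s_i, s'_i` odd positive integers, `s_i ≤ 2A - 1` and `s'_i ≤ A`. -/
def admissibleProducts (A p : ℕ) : Set ℝ :=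
  {x | ∃ (q q' : ℕ) (s : Fin q → ℕ) (s' : Fin q' → ℕ),
      2 * q + q' ≤ p ∧
      (∀ i, Odd (s i) ∧ 1 ≤ s i ∧ s i ≤ 2 * A - 1) ∧
      (∀ i, Odd (s' i) ∧ 1 ≤ s' i ∧ s' i ≤ A) ∧
      x = (∏ i, regMZV ![s i]) * regAntisymMZV s'}

/-! Write `n = 2h` and centre the variables by `m = k + h`. Since `n + 1` is odd, the symmetries
make the summand antisymmetric and odd in each `m_j`. Antisymmetry kills the tuples with a repeated
index, so the sum runs over strict chains. Averaging over sign changes and permutations, then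
splitting into partial fractions, turns the summand into a rational combination of determinants `det
(f_i (m_j))`, where each `f_i` is the odd part of some `1 / (m + j) ^ s` with `|j| ≤ h` and `s ≤ A`.

Summed over chains, such determinants define a linear form `chainForm` on the exterior algebra of
sequences. Its expansion along one entry (`chainForm_ι_mul`, in the spirit of de Bruijn's Pfaffian
formula) involves that entry `f` only through its simple sum `∑ f` and its pair sums `∑_{m > m'} (f
m * g m' - g m * f m')` with the other entries `g`.

The odd part of `1 / (m + j) ^ s` differs from that of `1 / m ^ s` by a telescoping term `u (m + 1)
- u m`, where `u m + u (m + 1)` is even in `m`. Replacing the former by the latter changes the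
simple sum by a quantity of rational regularized value. By summation by parts it changes a pair sum
by a boundary term and by the sum of `g m * (u m + u (m + 1))`, an odd rational function with poles
of order at most `2A`; parity leaves only rationals and `ζ_*(r)` with `r ≤ 2A - 1` odd. Each such
zeta value consumes two entries, whence `2q + q' ≤ p`.

Induction on the length and on the number of shifted entries leaves only entries `1 / m ^ s` with
`s` odd, whose chain form is a truncated antisymmetric multiple zeta value. -/

open Filter Asymptotics Topology

/-! ### Growth bounds up to `N ^ ε`. -/

/-- `u N = O_ε (N ^ (a + ε))` for every `ε > 0`. -/
def PowBound (a : ℝ) (u : ℕ → ℝ) : Prop :=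
  ∀ ε : ℝ, 0 < ε → u =O[atTop] fun N : ℕ => (N : ℝ) ^ (a + ε)

theorem isHarmonicExpansion_iff {u : ℕ → ℝ} {Q : Polynomial ℝ} :
    IsHarmonicExpansion u Q ↔ PowBound (-1) fun N => u N - Q.eval (harmonic N : ℝ) := Iff.rfl

theorem natCast_rpow_isBigO_of_le {a b : ℝ} (h : a ≤ b) :
    (fun N : ℕ => (N : ℝ) ^ a) =O[atTop] fun N : ℕ => (N : ℝ) ^ b := by
  refine IsBigO.of_bound 1 ?_
  filter_upwards [eventually_ge_atTop 1] with N hN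
  have hN' : (1 : ℝ) ≤ N := by exact_mod_cast hN
  rw [one_mul, Real.norm_of_nonneg (by positivity), Real.norm_of_nonneg (by positivity)]
  exact Real.rpow_le_rpow_of_exponent_le hN' h

theorem natCast_succ_rpow_isBigO (a : ℝ) :
    (fun N : ℕ => ((N + 1 : ℕ) : ℝ) ^ a) =O[atTop] fun N : ℕ => (N : ℝ) ^ a := by
  -- For `a ≥ 0` the constant comes from `N + 1 ≤ 2N`; for `a ≤ 0` the power decreases and any
  -- constant at least `1` works.
  refine IsBigO.of_bound (2 ^ |a|) ?_
  filter_upwards [eventually_ge_atTop 1] with N hN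
  have hN' : (1 : ℝ) ≤ N := by exact_mod_cast hN
  rw [Real.norm_of_nonneg (by positivity), Real.norm_of_nonneg (by positivity)]
  have h2 : (1 : ℝ) ≤ 2 ^ |a| := Real.one_le_rpow (by norm_num) (abs_nonneg a)
  rcases le_total 0 a with ha | ha
  · rw [abs_of_nonneg ha, ← Real.mul_rpow (by norm_num) (by positivity)]
    refine Real.rpow_le_rpow (by positivity) ?_ ha
    push_cast; linarith
  · calc ((N + 1 : ℕ) : ℝ) ^ a ≤ (N : ℝ) ^ a :=
          Real.rpow_le_rpow_of_nonpos (by positivity) (by push_cast; linarith) ha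
      _ ≤ _ := le_mul_of_one_le_left (by positivity) h2

namespace PowBound

variable {a b : ℝ} {u v : ℕ → ℝ}

theorem mono (hu : PowBound a u) (h : a ≤ b) : PowBound b u := fun ε hε =>
  (hu ε hε).trans (natCast_rpow_isBigO_of_le (by linarith))

theorem add (hu : PowBound a u) (hv : PowBound a v) : PowBound a fun N => u N + v N :=
  fun ε hε => (hu ε hε).add (hv ε hε)

theorem sub (hu : PowBound a u) (hv : PowBound a v) : PowBound a fun N => u N - v N :=
  fun ε hε => (hu ε hε).sub (hv ε hε)

theorem mul (hu : PowBound a u) (hv : PowBound b v) : PowBound (a + b) fun N => u N * v N := by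
  intro ε hε
  refine ((hu (ε / 2) (by linarith)).mul (hv (ε / 2) (by linarith))).trans_eventuallyEq ?_
  filter_upwards [eventually_ge_atTop 1] with N hN
  have hN' : (0 : ℝ) < N := by exact_mod_cast hN
  rw [← Real.rpow_add hN']
  ring_nf

theorem const (c : ℝ) : PowBound 0 fun _ => c := by
  intro ε hε
  refine IsBigO.of_bound |c| ?_
  filter_upwards [eventually_ge_atTop 1] with N hN
  have hN' : (1 : ℝ) ≤ N := by exact_mod_cast hN
  rw [Real.norm_eq_abs, Real.norm_of_nonneg (by positivity)]
  exact le_mul_of_one_le_right (abs_nonneg c) (Real.one_le_rpow hN' (by linarith))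

theorem const_mul (c : ℝ) (hu : PowBound a u) : PowBound a fun N => c * u N := by
  simpa using (const c).mul hu

theorem zero (a : ℝ) : PowBound a fun _ => 0 := fun _ _ => isBigO_zero _ _

theorem succ (hu : PowBound a u) : PowBound a fun N => u (N + 1) := fun ε hε =>
  ((hu ε hε).comp_tendsto (tendsto_add_atTop_nat 1)).trans (natCast_succ_rpow_isBigO _)

theorem congr' (hu : PowBound a u) (h : u =ᶠ[atTop] v) : PowBound a v := fun ε hε =>
  (hu ε hε).congr' h EventuallyEq.rfl

theorem inv_natCast : PowBound (-1) fun N : ℕ => 1 / (N : ℝ) := by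
  intro ε hε
  refine IsBigO.trans ?_ (natCast_rpow_isBigO_of_le (a := -1) (by linarith))
  refine (isBigO_refl _ _).congr_left fun N => ?_
  rw [Real.rpow_neg_one, one_div]

theorem inv_natCast_succ : PowBound (-1) fun N : ℕ => 1 / ((N : ℝ) + 1) := by
  simpa using inv_natCast.succ

theorem harmonic : PowBound 0 fun N => (harmonic N : ℝ) := by
  intro ε hε
  have h1 : (fun N : ℕ => 1 + Real.log N) =O[atTop] fun N : ℕ => (N : ℝ) ^ ((0 : ℝ) + ε) := by
    refine IsBigO.add (const 1 ε hε) ?_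
    rw [zero_add]
    exact (isLittleO_log_rpow_atTop hε).isBigO.comp_tendsto tendsto_natCast_atTop_atTop
  refine IsBigO.trans (IsBigO.of_bound 1 ?_) h1
  refine Eventually.of_forall fun N => ?_
  have := harmonic_le_one_add_log N
  have h0 : (0 : ℝ) ≤ (_root_.harmonic N : ℝ) := by
    exact_mod_cast (by unfold _root_.harmonic; positivity : (0 : ℚ) ≤ _root_.harmonic N)
  rw [Real.norm_of_nonneg h0, one_mul, Real.norm_of_nonneg (h0.trans this)]
  exact this

theorem pow (hu : PowBound 0 u) (n : ℕ) : PowBound 0 fun N => u N ^ n := by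
  induction n with
  | zero => simpa using const 1
  | succ n ih => simpa [pow_succ] using ih.mul hu

theorem polynomial_eval (hu : PowBound 0 u) (Q : Polynomial ℝ) :
    PowBound 0 fun N => Q.eval (u N) := by
  induction Q using Polynomial.induction_on' with
  | add p q hp hq => simpa using hp.add hq
  | monomial n c => simpa using (hu.pow n).const_mul c

/-- If `v = u + O(N^(-1+ε))` with `u` subpolynomial, then `Q(v) = Q(u) + O(N^(-1+ε))`. -/
theorem eval_sub_eval (hu : PowBound 0 u) (h : PowBound (-1) fun N => v N - u N)
    (Q : Polynomial ℝ) : PowBound (-1) fun N => Q.eval (v N) - Q.eval (u N) := by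
  have hv : PowBound 0 v := by simpa using (h.mono (by norm_num : (-1 : ℝ) ≤ 0)).add hu
  induction Q using Polynomial.induction_on' with
  | add p q hp hq =>
    refine (hp.add hq).congr' (Eventually.of_forall fun N => ?_)
    simp only [Polynomial.eval_add]; ring
  | monomial n c =>
    have key : PowBound (-1) fun N => v N ^ n - u N ^ n := by
      induction n with
      | zero => simpa using zero (-1)
      | succ n ih =>
        have h1 := hv.mul ih
        have h2 := (hu.pow n).mul h
        rw [zero_add] at h1 h2
        refine (h1.add h2).congr' (Eventually.of_forall fun N => ?_)
        ring
    refine (key.const_mul c).congr' (Eventually.of_forall fun N => ?_)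
    simp only [Polynomial.eval_monomial]; ring

theorem inv_pow_succ {s : ℕ} (hs : 1 ≤ s) : PowBound (-1) fun N : ℕ => 1 / ((N : ℝ) + 1) ^ s := by
  obtain ⟨s, rfl⟩ := Nat.exists_eq_add_of_le' hs
  have h := ((inv_natCast_succ.mono (by norm_num : (-1 : ℝ) ≤ 0)).pow s).mul inv_natCast_succ
  rw [zero_add] at h
  refine h.congr' (Eventually.of_forall fun N => ?_)
  simp [pow_succ, mul_comm]

theorem inv_pow_succ_two {s : ℕ} (hs : 2 ≤ s) :
    PowBound (-2) fun N : ℕ => 1 / ((N : ℝ) + 1) ^ s := by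
  obtain ⟨s, rfl⟩ := Nat.exists_eq_add_of_le' hs
  have h := (inv_pow_succ (s := s + 1) (by omega)).mul inv_natCast_succ
  rw [show (-1 : ℝ) + -1 = -2 by norm_num] at h
  refine h.congr' (Eventually.of_forall fun N => ?_)
  simp [pow_succ, mul_comm]

end PowBound

/-! ### From differences of a sequence to its harmonic expansion. -/

/-- Bernoulli's inequality for the exponent `a ≤ 1` gives `(1 - 1 / (N + 1)) ^ a ≤ 1 - a / (N + 1)`,
and `1 / (N + 1) ≥ 1 / (2N)`. It bounds tails of `∑ N ^ (-1 - a)` by telescoping, without integrals.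
-/
theorem rpow_neg_sub_rpow_neg_succ {a : ℝ} (ha : 0 < a) (ha1 : a ≤ 1) {N : ℕ} (hN : 1 ≤ N) :
    a / 2 * (N : ℝ) ^ (-1 - a) ≤ (N : ℝ) ^ (-a) - ((N + 1 : ℕ) : ℝ) ^ (-a) := by
  have hN' : (1 : ℝ) ≤ N := by exact_mod_cast hN
  have h0 : (0 : ℝ) < N := by linarith
  have h1 : ((N + 1 : ℕ) : ℝ) ^ (-a) = (N : ℝ) ^ (-a) * (1 + -(1 / ((N : ℝ) + 1))) ^ a := by
    have : 1 + -(1 / ((N : ℝ) + 1)) = N / ((N : ℝ) + 1) := by field_simp; ring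
    rw [this, Real.div_rpow h0.le (by positivity), Real.rpow_neg h0.le, Real.rpow_neg (by positivity)]
    push_cast
    have := (Real.rpow_pos_of_pos h0 a).ne'
    field_simp
  have h2 := rpow_one_add_le_one_add_mul_self (s := -(1 / ((N : ℝ) + 1))) (p := a)
    (by rw [neg_le_neg_iff, div_le_one (by positivity)]; linarith) ha.le ha1
  have h3 : (N : ℝ) ^ (-1 - a) = (N : ℝ) ^ (-a) * (1 / N) := by
    rw [show -1 - a = -a + -1 by ring, Real.rpow_add h0, Real.rpow_neg_one, one_div]
  have hp : 0 < (N : ℝ) ^ (-a) := Real.rpow_pos_of_pos h0 _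
  have h4 : 1 / 2 * (1 / (N : ℝ)) ≤ 1 / ((N : ℝ) + 1) := by
    rw [div_mul_div_comm, div_le_div_iff₀ (by positivity) (by positivity)]; linarith
  rw [h1, h3]
  nlinarith [mul_le_mul_of_nonneg_left h2 hp.le, mul_le_mul_of_nonneg_left h4 (mul_pos ha hp).le]

/-- A sequence whose differences are `O(N^(-2+ε))` converges with error `O(N^(-1+ε))`. -/
theorem PowBound.exists_limit {x : ℕ → ℝ} (h : PowBound (-2) fun N => x (N + 1) - x N) :
    ∃ c : ℝ, PowBound (-1) fun N => x N - c := by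
  have hs : Summable fun N => x (N + 1) - x N := by
    refine summable_of_isBigO_nat ?_ (h (1 / 2) (by norm_num))
    exact Real.summable_nat_rpow.mpr (by norm_num)
  have hx : Tendsto x atTop (𝓝 (x 0 + ∑' N, (x (N + 1) - x N))) := by
    have := hs.hasSum.tendsto_sum_nat.const_add (x 0)
    refine this.congr fun N => ?_
    rw [Finset.sum_range_sub]; ring
  set c := x 0 + ∑' N, (x (N + 1) - x N)
  refine ⟨c, ?_⟩
  -- With `ε < 1`, the exponent `a = 1 - ε` is positive and the telescoping comparison with `k ^
  -- (-a)` applies; larger `ε` follow by monotonicity.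
  have key : ∀ ε : ℝ, 0 < ε → ε < 1 → (fun N => x N - c) =O[atTop] fun N : ℕ => (N : ℝ) ^ (-1 + ε) := by
    intro ε hε hε1
    obtain ⟨K, hK, hb⟩ := (h ε hε).exists_pos
    obtain ⟨N₀, hN₀⟩ := eventually_atTop.1 hb.bound
    set a := 1 - ε with ha
    have ha0 : 0 < a := by linarith
    refine IsBigO.of_bound (K * (2 / a)) ?_
    filter_upwards [eventually_ge_atTop (max N₀ 1)] with N hN
    have step : ∀ k, N ≤ k → |x (k + 1) - x k| ≤
        K * (2 / a) * ((k : ℝ) ^ (-a) - ((k + 1 : ℕ) : ℝ) ^ (-a)) := by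
      intro k hk
      have h1 := hN₀ k (by omega)
      have h2 := rpow_neg_sub_rpow_neg_succ ha0 (by linarith) (N := k) (by omega)
      rw [Real.norm_of_nonneg (Real.rpow_nonneg (Nat.cast_nonneg k) _), Real.norm_eq_abs,
        show (-2 + ε) = -1 - a by rw [ha]; ring] at h1
      refine h1.trans ?_
      calc K * (k : ℝ) ^ (-1 - a) = K * (2 / a) * (a / 2 * (k : ℝ) ^ (-1 - a)) := by field_simp
        _ ≤ _ := mul_le_mul_of_nonneg_left h2 (by positivity)
    have tele : ∀ j, |x (N + j) - x N| ≤
        K * (2 / a) * ((N : ℝ) ^ (-a) - ((N + j : ℕ) : ℝ) ^ (-a)) := by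
      intro j
      induction j with
      | zero => simp
      | succ j ih =>
        have h1 := step (N + j) (by omega)
        have h2 := abs_add_le (x (N + j + 1) - x (N + j)) (x (N + j) - x N)
        rw [sub_add_sub_cancel] at h2
        rw [← add_assoc]
        linarith
    have bd : ∀ j, |x (N + j) - x N| ≤ K * (2 / a) * (N : ℝ) ^ (-a) := fun j =>
      (tele j).trans (mul_le_mul_of_nonneg_left
        (sub_le_self _ (Real.rpow_nonneg (Nat.cast_nonneg _) _)) (by positivity))
    have hlim : Tendsto (fun j => |x (N + j) - x N|) atTop (𝓝 |c - x N|) := by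
      refine Tendsto.abs (Tendsto.sub_const ?_ _)
      exact (hx.comp (tendsto_add_atTop_nat N)).congr fun j => by simp [add_comm]
    have := le_of_tendsto' hlim bd
    rw [Real.norm_eq_abs, abs_sub_comm, Real.norm_of_nonneg (Real.rpow_nonneg (Nat.cast_nonneg N) _),
      show -1 + ε = -a by rw [ha]; ring]
    exact this
  intro ε hε
  refine (key (min ε (1 / 2)) (by positivity) (by
    exact (min_le_right _ _).trans_lt (by norm_num))).trans (natCast_rpow_isBigO_of_le ?_)
  linarith [min_le_left ε (1 / 2)]

theorem harmonic_succ_cast (N : ℕ) : (harmonic (N + 1) : ℝ) = harmonic N + 1 / ((N : ℝ) + 1) := by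
  rw [harmonic_succ]; push_cast; rw [one_div]

/-- Discrete antiderivative: as `H_{N+1} - H_N = 1 / (N + 1)`, the increment of `H_N ^ (n + 1)` is
`(n + 1) * H_N ^ n / (N + 1)` up to terms containing `1 / (N + 1) ^ 2`. Hence `X ^ n` integrates to
`X ^ (n + 1) / (n + 1)`, as for ordinary polynomials. -/
theorem exists_harmonic_primitive (Q : Polynomial ℝ) : ∃ R : Polynomial ℝ,
    PowBound (-2) fun N => R.eval (harmonic (N + 1) : ℝ) - R.eval (harmonic N : ℝ) -
      Q.eval (harmonic N : ℝ) / ((N : ℝ) + 1) := by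
  induction Q using Polynomial.induction_on' with
  | add p q hp hq =>
    obtain ⟨R, hR⟩ := hp
    obtain ⟨S, hS⟩ := hq
    refine ⟨R + S, (hR.add hS).congr' (Eventually.of_forall fun N => ?_)⟩
    simp only [Polynomial.eval_add]; ring
  | monomial n c =>
    have key : ∀ n : ℕ, PowBound (-2) fun N => (harmonic (N + 1) : ℝ) ^ (n + 1) -
        (harmonic N : ℝ) ^ (n + 1) - (n + 1) * (harmonic N : ℝ) ^ n / ((N : ℝ) + 1) := by
      intro n
      induction n with
      | zero =>
        refine (PowBound.zero _).congr' (Eventually.of_forall fun N => ?_)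
        simp
      | succ n ih =>
        have h1 := PowBound.harmonic.succ.mul ih
        have h2 := ((PowBound.harmonic.pow n).mul
          (PowBound.inv_pow_succ_two (s := 2) le_rfl)).const_mul (n + 1)
        rw [zero_add] at h1 h2
        refine (h1.add h2).congr' (Eventually.of_forall fun N => ?_)
        have hv := harmonic_succ_cast N
        simp only [div_eq_mul_inv, one_mul, ← inv_pow] at hv ⊢
        generalize ((N : ℝ) + 1)⁻¹ = δ at hv ⊢
        rw [← sub_eq_iff_eq_add'] at hv
        subst hv
        push_cast
        ring
    refine ⟨Polynomial.monomial (n + 1) (c / (n + 1)),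
      ((key n).const_mul (c / (n + 1))).congr' (Eventually.of_forall fun N => ?_)⟩
    simp only [Polynomial.eval_monomial]
    have : (N : ℝ) + 1 ≠ 0 := by positivity
    have : (n : ℝ) + 1 ≠ 0 := by positivity
    field_simp

namespace IsHarmonicExpansion

variable {u v : ℕ → ℝ} {Q R : Polynomial ℝ}

theorem powBound (h : IsHarmonicExpansion u Q) : PowBound 0 u := by
  have := ((isHarmonicExpansion_iff.1 h).mono (by norm_num : (-1 : ℝ) ≤ 0)).add
    (PowBound.harmonic.polynomial_eval Q)
  simpa using this

/-- Partial summation against `1 / k ^ s` preserves harmonic expansions. -/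
theorem exists_of_succ (h : IsHarmonicExpansion u Q) {s : ℕ} (hs : 1 ≤ s)
    (hv : ∀ N, v (N + 1) = v N + u N / ((N : ℝ) + 1) ^ s) :
    ∃ R : Polynomial ℝ, IsHarmonicExpansion v R := by
  -- For `s = 1` the main term is absorbed by a primitive of `Q`; for `s ≥ 2` the increments are
  -- `O(N ^ (-2 + ε))` and `v` converges.
  rcases hs.eq_or_lt with rfl | hs
  · obtain ⟨R, hR⟩ := exists_harmonic_primitive Q
    have h1 := (isHarmonicExpansion_iff.1 h).mul PowBound.inv_natCast_succ
    rw [show (-1 : ℝ) + -1 = -2 by norm_num] at h1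
    obtain ⟨c, hc⟩ := PowBound.exists_limit
      (x := fun N => v N - R.eval (harmonic N : ℝ)) ((h1.sub hR).congr'
        (Eventually.of_forall fun N => by simp only [hv]; ring))
    refine ⟨R + Polynomial.C c, hc.congr' (Eventually.of_forall fun N => ?_)⟩
    simp only [Polynomial.eval_add, Polynomial.eval_C]; ring
  · have h1 := h.powBound.mul (PowBound.inv_pow_succ_two (s := s) hs)
    rw [zero_add] at h1
    obtain ⟨c, hc⟩ := PowBound.exists_limit (x := v) (h1.congr'
        (Eventually.of_forall fun N => by simp only [hv]; ring))
    exact ⟨Polynomial.C c, by simpa [isHarmonicExpansion_iff] using hc⟩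

end IsHarmonicExpansion

/-! ### Calculus of regularized values. -/

/-- `c` is the constant term of a harmonic expansion of `u`. -/
def HasRegValue (u : ℕ → ℝ) (c : ℝ) : Prop :=
  ∃ Q : Polynomial ℝ, IsHarmonicExpansion u Q ∧ Q.eval 0 = c

namespace HasRegValue

variable {u v : ℕ → ℝ} {c d : ℝ}

theorem of_negligible (h : PowBound (-1) fun N => u N - c) : HasRegValue u c :=
  ⟨Polynomial.C c, by simpa [isHarmonicExpansion_iff] using h, by simp⟩

theorem const (c : ℝ) : HasRegValue (fun _ => c) c :=
  of_negligible (by simpa using PowBound.zero (-1))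

theorem add (hu : HasRegValue u c) (hv : HasRegValue v d) :
    HasRegValue (fun N => u N + v N) (c + d) := by
  obtain ⟨Q, hQ, rfl⟩ := hu
  obtain ⟨R, hR, rfl⟩ := hv
  refine ⟨Q + R, (PowBound.add hQ hR).congr' (Eventually.of_forall fun N => ?_), by simp⟩
  simp only [Polynomial.eval_add]; ring

theorem mul (hu : HasRegValue u c) (hv : HasRegValue v d) :
    HasRegValue (fun N => u N * v N) (c * d) := by
  obtain ⟨Q, hQ, rfl⟩ := hu
  obtain ⟨R, hR, rfl⟩ := hv
  refine ⟨Q * R, ?_, by simp⟩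
  have h1 := PowBound.mul hQ hR.powBound
  have h2 := (PowBound.harmonic.polynomial_eval Q).mul hR
  rw [add_zero] at h1
  rw [zero_add] at h2
  refine (h1.add h2).congr' (Eventually.of_forall fun N => ?_)
  simp only [Polynomial.eval_mul]; ring

theorem const_mul (a : ℝ) (hu : HasRegValue u c) : HasRegValue (fun N => a * u N) (a * c) :=
  (const a).mul hu

theorem sub (hu : HasRegValue u c) (hv : HasRegValue v d) :
    HasRegValue (fun N => u N - v N) (c - d) := by
  simpa [sub_eq_add_neg] using hu.add (hv.const_mul (-1))

theorem sum {ι : Type*} (s : Finset ι) {u : ι → ℕ → ℝ} {c : ι → ℝ}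
    (h : ∀ i ∈ s, HasRegValue (u i) (c i)) :
    HasRegValue (fun N => ∑ i ∈ s, u i N) (∑ i ∈ s, c i) := by
  classical
  induction s using Finset.induction_on with
  | empty => simpa using const 0
  | insert a s ha ih =>
    simp only [Finset.sum_insert ha]
    exact (h a (by simp)).add (ih fun i hi => h i (by simp [hi]))

/-- `H_{N+1} - H_N` is negligible, so the same polynomial serves after translation. This permits the
change of variables `m = k + h`. -/
theorem succ (hu : HasRegValue u c) : HasRegValue (fun N => u (N + 1)) c := by
  obtain ⟨Q, hQ, rfl⟩ := hu
  refine ⟨Q, ?_, rfl⟩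
  have h1 : PowBound (-1) fun N => (harmonic (N + 1) : ℝ) - harmonic N := by
    simpa [harmonic_succ_cast] using PowBound.inv_natCast_succ
  have h2 := PowBound.eval_sub_eval PowBound.harmonic h1 Q
  refine ((PowBound.succ hQ).add h2).congr' (Eventually.of_forall fun N => ?_)
  ring

theorem shift (hu : HasRegValue u c) (h : ℕ) : HasRegValue (fun N => u (N + h)) c := by
  induction h with
  | zero => exact hu
  | succ h ih => simpa [add_assoc, add_comm, add_left_comm] using ih.succ

end HasRegValue

/-! ### Strict chains and truncated multiple zeta values. -/

/-- The strictly decreasing tuples `N ≥ k₁ > ⋯ > k_p ≥ 1`. -/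
def strictChains (p N : ℕ) : Finset (Fin p → ℕ) :=
  (Fintype.piFinset fun _ : Fin p => Finset.Icc 1 N).filter fun k => ∀ i j, i < j → k j < k i

theorem mem_strictChains {p N : ℕ} {k : Fin p → ℕ} :
    k ∈ strictChains p N ↔ (∀ i, 1 ≤ k i ∧ k i ≤ N) ∧ ∀ i j, i < j → k j < k i := by
  simp [strictChains, Fintype.mem_piFinset]

theorem cons_mem_strictChains {p N a : ℕ} {k : Fin p → ℕ} :
    (Fin.cons a k : Fin (p + 1) → ℕ) ∈ strictChains (p + 1) N ↔
      1 ≤ a ∧ a ≤ N ∧ k ∈ strictChains p (a - 1) := by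
  simp only [mem_strictChains, Fin.forall_fin_succ, Fin.cons_zero, Fin.cons_succ, false_imp_iff,
    Fin.succ_pos, true_imp_iff, not_lt_zero, Fin.succ_lt_succ_iff, true_and]
  constructor
  · rintro ⟨⟨⟨h1, h2⟩, h3⟩, h4, h5⟩
    exact ⟨h1, h2, fun i => ⟨(h3 i).1, by have := h4 i; omega⟩, h5⟩
  · rintro ⟨h1, h2, h3, h4⟩
    exact ⟨⟨⟨h1, h2⟩, fun i => ⟨(h3 i).1, by have := h3 i; omega⟩⟩,
      fun i => by have := h3 i; omega, h4⟩

theorem sum_strictChains_zero {K : Type*} [AddCommMonoid K] (N : ℕ) (G : (Fin 0 → ℕ) → K) :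
    ∑ k ∈ strictChains 0 N, G k = G Fin.elim0 := by
  have : strictChains 0 N = {Fin.elim0} := by
    ext k
    simp [mem_strictChains, Subsingleton.elim k Fin.elim0]
  rw [this, Finset.sum_singleton]

theorem strictChains_succ_zero (p : ℕ) : strictChains (p + 1) 0 = ∅ := by
  ext k
  simp only [mem_strictChains, Finset.notMem_empty, iff_false]
  rintro ⟨h, -⟩
  have := h 0
  omega

/-- Chains bounded by `N + 1` split according to whether their largest element is `N + 1`. -/
theorem sum_strictChains_succ {K : Type*} [AddCommMonoid K] (p N : ℕ)
    (G : (Fin (p + 1) → ℕ) → K) :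
    ∑ k ∈ strictChains (p + 1) (N + 1), G k =
      ∑ k ∈ strictChains (p + 1) N, G k + ∑ k ∈ strictChains p N, G (Fin.cons (N + 1) k) := by
  rw [← Finset.sum_filter_not_add_sum_filter _ (fun k => k 0 = N + 1)]
  congr 1
  · refine Finset.sum_congr ?_ fun _ _ => rfl
    ext k
    rw [Finset.mem_filter, ← Fin.cons_self_tail k, cons_mem_strictChains, cons_mem_strictChains,
      Fin.cons_zero]
    constructor
    · rintro ⟨⟨h1, h2, h3⟩, h4⟩
      exact ⟨h1, by omega, h3⟩
    · rintro ⟨h1, h2, h3⟩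
      exact ⟨⟨h1, by omega, h3⟩, by omega⟩
  · refine Finset.sum_nbij' Fin.tail (fun k => Fin.cons (N + 1) k) ?_ ?_ ?_ ?_ ?_
    · intro k hk
      rw [Finset.mem_filter, ← Fin.cons_self_tail k, cons_mem_strictChains, Fin.cons_zero] at hk
      obtain ⟨⟨h1, h2, h3⟩, h4⟩ := hk
      rwa [h4, Nat.add_sub_cancel] at h3
    · intro k hk
      rw [Finset.mem_filter, cons_mem_strictChains, Fin.cons_zero]
      exact ⟨⟨by omega, le_rfl, by simpa using hk⟩, rfl⟩
    · intro k hk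
      rw [← (Finset.mem_filter.1 hk).2]
      exact Fin.cons_self_tail k
    · intro k _
      exact Fin.tail_cons _ _
    · intro k hk
      rw [← (Finset.mem_filter.1 hk).2, Fin.cons_self_tail]

theorem truncatedMZV_eq_sum {p : ℕ} (s : Fin p → ℕ) (N : ℕ) :
    truncatedMZV s N = ∑ k ∈ strictChains p N, ∏ i, 1 / (k i : ℝ) ^ s i := rfl

theorem truncatedMZV_succ {p : ℕ} (s : Fin (p + 1) → ℕ) (N : ℕ) :
    truncatedMZV s (N + 1) =
      truncatedMZV s N + truncatedMZV (Fin.tail s) N / ((N : ℝ) + 1) ^ s 0 := by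
  rw [truncatedMZV_eq_sum, sum_strictChains_succ, truncatedMZV_eq_sum, truncatedMZV_eq_sum,
    Finset.sum_div]
  congr 1
  refine Finset.sum_congr rfl fun k _ => ?_
  rw [Fin.prod_univ_succ]
  simp [Fin.tail, div_eq_inv_mul]

/-- Isolating the largest index writes the increment in `N` as a sum of smaller depth divided by `(N
+ 1) ^ s₀`, so partial summation applies inductively. -/
theorem exists_isHarmonicExpansion_truncatedMZV {p : ℕ} (s : Fin p → ℕ) (hs : ∀ i, 1 ≤ s i) :
    ∃ Q : Polynomial ℝ, IsHarmonicExpansion (truncatedMZV s) Q := by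
  induction p with
  | zero =>
    refine ⟨1, ?_⟩
    refine (PowBound.zero _).congr' (Eventually.of_forall fun N => ?_)
    beta_reduce
    rw [truncatedMZV_eq_sum, sum_strictChains_zero]
    simp
  | succ p ih =>
    obtain ⟨Q, hQ⟩ := ih (Fin.tail s) fun i => hs i.succ
    exact hQ.exists_of_succ (hs 0) (truncatedMZV_succ s)

theorem hasRegValue_truncatedMZV {p : ℕ} (s : Fin p → ℕ) (hs : ∀ i, 1 ≤ s i) :
    HasRegValue (truncatedMZV s) (regMZV s) := by
  obtain ⟨Q, hQ⟩ := exists_isHarmonicExpansion_truncatedMZV s hs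
  exact ⟨Q, hQ, (regMZV_eq hQ).symm⟩

theorem truncatedMZV_one (s N : ℕ) :
    truncatedMZV ![s] N = ∑ m ∈ Finset.range N, 1 / ((m : ℝ) + 1) ^ s := by
  induction N with
  | zero => simp [truncatedMZV_eq_sum, strictChains_succ_zero]
  | succ N ih =>
    rw [truncatedMZV_succ, ih, Finset.sum_range_succ, truncatedMZV_eq_sum, sum_strictChains_zero]
    simp

/-! ### Chain sums of determinants as a linear form on the exterior algebra. -/

section ChainForm

open CliffordAlgebra

variable {K : Type*} [CommRing K]

/-- The even and odd parts of the linear form on the exterior algebra of the sequences which maps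
`f₁ ∧ ⋯ ∧ f_p` to `∑_{N ≥ m₁ > ⋯ > m_p ≥ 1} det (f_i (m_j))`. -/
def chainFormPair : ℕ →
    (ExteriorAlgebra K (ℕ → K) →ₗ[K] K) × (ExteriorAlgebra K (ℕ → K) →ₗ[K] K)
  | 0 => (ExteriorAlgebra.algebraMapInv.toLinearMap, 0)
  | N + 1 =>
    ((chainFormPair N).1 + (chainFormPair N).2 ∘ₗ contractLeft (LinearMap.proj (N + 1)),
      (chainFormPair N).2 + (chainFormPair N).1 ∘ₗ contractLeft (LinearMap.proj (N + 1)))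

/-- The even part of the chain form. -/
def evenChainForm (N : ℕ) : ExteriorAlgebra K (ℕ → K) →ₗ[K] K := (chainFormPair N).1

/-- The odd part of the chain form. -/
def oddChainForm (N : ℕ) : ExteriorAlgebra K (ℕ → K) →ₗ[K] K := (chainFormPair N).2

theorem evenChainForm_zero (y : ExteriorAlgebra K (ℕ → K)) :
    evenChainForm 0 y = ExteriorAlgebra.algebraMapInv y := rfl

theorem oddChainForm_zero (y : ExteriorAlgebra K (ℕ → K)) : oddChainForm 0 y = 0 := rfl

theorem evenChainForm_succ (N : ℕ) (y : ExteriorAlgebra K (ℕ → K)) :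
    evenChainForm (N + 1) y =
      evenChainForm N y + oddChainForm N (contractLeft (LinearMap.proj (N + 1)) y) := rfl

theorem oddChainForm_succ (N : ℕ) (y : ExteriorAlgebra K (ℕ → K)) :
    oddChainForm (N + 1) y =
      oddChainForm N y + evenChainForm N (contractLeft (LinearMap.proj (N + 1)) y) := rfl

/-- The linear form `f ↦ ∑_{m=1}^N f m`. -/
def partialSum (K : Type*) [CommRing K] : ℕ → Module.Dual K (ℕ → K)
  | 0 => 0
  | N + 1 => partialSum K N + LinearMap.proj (N + 1)

@[simp] theorem partialSum_zero (f : ℕ → K) : partialSum K 0 f = 0 := rfl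

theorem partialSum_succ (N : ℕ) : partialSum K (N + 1) = partialSum K N + LinearMap.proj (N + 1) :=
  rfl

@[simp] theorem partialSum_succ_apply (N : ℕ) (f : ℕ → K) :
    partialSum K (N + 1) f = partialSum K N f + f (N + 1) := rfl

/-- The linear form `g ↦ ∑_{N ≥ m > m' ≥ 1} (f m * g m' - g m * f m')`. -/
def pairSum (f : ℕ → K) : ℕ → Module.Dual K (ℕ → K)
  | 0 => 0
  | N + 1 => pairSum f N + f (N + 1) • partialSum K N - partialSum K N f • LinearMap.proj (N + 1)

@[simp] theorem pairSum_zero (f g : ℕ → K) : pairSum f 0 g = 0 := rfl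

theorem pairSum_succ (f : ℕ → K) (N : ℕ) : pairSum f (N + 1) =
    pairSum f N + f (N + 1) • partialSum K N - partialSum K N f • LinearMap.proj (N + 1) := rfl

@[simp] theorem pairSum_succ_apply (f : ℕ → K) (N : ℕ) (g : ℕ → K) : pairSum f (N + 1) g =
    pairSum f N g + f (N + 1) * partialSum K N g - partialSum K N f * g (N + 1) := rfl

/-- The odd part is determined by the even part: an odd chain sum is an alternating sum of simple
sums times even chain sums. The induction uses only that contractions anticommute and square to
zero. -/
theorem oddChainForm_eq (N : ℕ) (y : ExteriorAlgebra K (ℕ → K)) :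
    oddChainForm N y = evenChainForm N (contractLeft (partialSum K N) y) := by
  induction N generalizing y with
  | zero => simp [oddChainForm_zero, partialSum]
  | succ N ih =>
    have h := ih (contractLeft (LinearMap.proj (N + 1)) y)
    rw [contractLeft_comm, map_neg] at h
    rw [oddChainForm_succ, evenChainForm_succ, ih, partialSum_succ]
    simp only [map_add, LinearMap.add_apply, contractLeft_contractLeft, add_zero]
    rw [contractLeft_comm, map_neg, ih, contractLeft_comm, map_neg, contractLeft_comm,
      contractLeft_contractLeft]
    simp

theorem oddChainForm_contractLeft_partialSum (N : ℕ) (y : ExteriorAlgebra K (ℕ → K)) :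
    oddChainForm N (contractLeft (partialSum K N) y) = 0 := by
  rw [oddChainForm_eq, contractLeft_contractLeft, map_zero]

theorem algebraMapInv_ι (f : ℕ → K) :
    ExteriorAlgebra.algebraMapInv (ExteriorAlgebra.ι K f) = 0 := by
  simp [ExteriorAlgebra.algebraMapInv]

/-- Expansion along the first entry. In even length only pair sums of `f` with the other entries
occur, as in a Pfaffian expanded along a row; in odd length the border term with the simple sum of
`f` is added. -/
theorem chainFormPair_ι_mul (N : ℕ) (f : ℕ → K) (y : ExteriorAlgebra K (ℕ → K)) :
    evenChainForm N (ExteriorAlgebra.ι K f * y) = evenChainForm N (contractLeft (pairSum f N) y) ∧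
    oddChainForm N (ExteriorAlgebra.ι K f * y) =
      partialSum K N f * evenChainForm N y + oddChainForm N (contractLeft (pairSum f N) y) := by
  induction N generalizing y with
  | zero => simp [evenChainForm_zero, oddChainForm_zero, pairSum, algebraMapInv_ι]
  | succ N ih =>
    set δ : Module.Dual K (ℕ → K) := LinearMap.proj (N + 1) with hδ
    -- Evaluation at the new index `N + 1` is an antiderivation. The facts below move it past the
    -- other contractions and convert odd parts to even ones.
    have h1 : contractLeft δ (ExteriorAlgebra.ι K f * y) =
        f (N + 1) • y - ExteriorAlgebra.ι K f * contractLeft δ y :=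
      contractLeft_ι_mul (Q := (0 : QuadraticForm K (ℕ → K))) δ f y
    have h2 := contractLeft_comm δ (pairSum f N) y
    have h3 := contractLeft_comm δ (partialSum K N) y
    have h4 := oddChainForm_eq N (contractLeft δ y)
    have h5 := oddChainForm_contractLeft_partialSum N (contractLeft δ y)
    have h6 := oddChainForm_eq N y
    have h7 := oddChainForm_contractLeft_partialSum N y
    constructor
    · rw [evenChainForm_succ, evenChainForm_succ, (ih y).1, ← hδ, h1, map_sub, (ih _).2,
        pairSum_succ, ← hδ]
      simp only [map_add, map_sub, map_smul, LinearMap.add_apply, LinearMap.sub_apply,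
        LinearMap.smul_apply, contractLeft_contractLeft, smul_zero, sub_zero, h2, h3, map_neg, smul_eq_mul, h5, h6]
      ring
    · rw [oddChainForm_succ, oddChainForm_succ, evenChainForm_succ, (ih y).2, ← hδ, h1, map_sub,
        (ih _).1, pairSum_succ, partialSum_succ, ← hδ]
      simp only [map_add, map_sub, map_smul, LinearMap.add_apply, LinearMap.sub_apply,
        LinearMap.smul_apply, contractLeft_contractLeft, smul_zero, sub_zero, h2, h3, map_neg,
        smul_eq_mul, h4, h7]
      simp only [hδ, LinearMap.proj_apply]
      ring

/-- The antiderivation rule iterated over the factors; with `d` an evaluation it matches Laplace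
expansion of a determinant along a column. -/
theorem contractLeft_ιMulti (d : Module.Dual K (ℕ → K)) {p : ℕ} (f : Fin (p + 1) → ℕ → K) :
    contractLeft (Q := (0 : QuadraticForm K (ℕ → K))) d (ExteriorAlgebra.ιMulti K (p + 1) f) =
      ∑ i : Fin (p + 1), ((-1) ^ (i : ℕ) * d (f i)) •
        ExteriorAlgebra.ιMulti K p (f ∘ i.succAbove) := by
  have h (q : ℕ) (g : Fin (q + 1) → ℕ → K) :
      contractLeft (Q := (0 : QuadraticForm K (ℕ → K))) d (ExteriorAlgebra.ιMulti K (q + 1) g) =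
        d (g 0) • ExteriorAlgebra.ιMulti K q (Matrix.vecTail g) - ExteriorAlgebra.ι K (g 0) *
          contractLeft (Q := (0 : QuadraticForm K (ℕ → K))) d
            (ExteriorAlgebra.ιMulti K q (Matrix.vecTail g)) := by
    rw [ExteriorAlgebra.ιMulti_succ_apply]
    exact contractLeft_ι_mul (Q := (0 : QuadraticForm K (ℕ → K))) d (g 0) _
  induction p with
  | zero =>
    rw [h, ExteriorAlgebra.ιMulti_zero_apply, contractLeft_one]
    simp
  | succ p ih =>
    rw [h, ih, Fin.sum_univ_succ (n := p + 1), Finset.mul_sum, sub_eq_add_neg, ← Finset.sum_neg_distrib]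
    congr 1
    · simp [Matrix.vecTail, Function.comp_def]
    · refine Finset.sum_congr rfl fun i _ => ?_
      rw [ExteriorAlgebra.ιMulti_succ_apply, mul_smul_comm, ← neg_smul]
      congr 1
      · simp [Matrix.vecTail, pow_succ]
      · congr 2
        funext j
        simp [Matrix.vecTail]

/-- The linear form on the exterior algebra of the sequences which maps `f₁ ∧ ⋯ ∧ f_p` to
`∑_{N ≥ m₁ > ⋯ > m_p ≥ 1} det (f_i (m_j))`. -/
def chainForm (N : ℕ) : ExteriorAlgebra K (ℕ → K) →ₗ[K] K := evenChainForm N + oddChainForm N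

theorem chainForm_succ (N : ℕ) (y : ExteriorAlgebra K (ℕ → K)) :
    chainForm (N + 1) y =
      chainForm N y + chainForm N (contractLeft (LinearMap.proj (N + 1)) y) := by
  simp only [chainForm, LinearMap.add_apply, evenChainForm_succ, oddChainForm_succ]
  ring

theorem chainForm_ι_mul (N : ℕ) (f : ℕ → K) (y : ExteriorAlgebra K (ℕ → K)) :
    chainForm N (ExteriorAlgebra.ι K f * y) =
      partialSum K N f * evenChainForm N y + chainForm N (contractLeft (pairSum f N) y) := by
  simp only [chainForm, LinearMap.add_apply, (chainFormPair_ι_mul N f y).1,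
    (chainFormPair_ι_mul N f y).2]
  ring

/-- A chain bounded by `N + 1` either avoids `N + 1` or begins with it; in the second case the first
column of the determinant is the evaluation at `N + 1`. -/
theorem chainForm_ιMulti (N : ℕ) {p : ℕ} (f : Fin p → ℕ → K) :
    chainForm N (ExteriorAlgebra.ιMulti K p f) =
      ∑ k ∈ strictChains p N, (Matrix.of fun i j => f i (k j)).det := by
  induction N generalizing p with
  | zero =>
    cases p with
    | zero =>
      rw [sum_strictChains_zero, ExteriorAlgebra.ιMulti_zero_apply]
      simp [chainForm, evenChainForm_zero, oddChainForm_zero]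
    | succ p =>
      rw [strictChains_succ_zero, ExteriorAlgebra.ιMulti_succ_apply, Finset.sum_empty]
      simp [chainForm, evenChainForm_zero, oddChainForm_zero, algebraMapInv_ι]
  | succ N ih =>
    rw [chainForm_succ, ih]
    cases p with
    | zero =>
      rw [sum_strictChains_zero, sum_strictChains_zero, ExteriorAlgebra.ιMulti_zero_apply,
        contractLeft_one]
      simp
    | succ p =>
      rw [sum_strictChains_succ, contractLeft_ιMulti, map_sum]
      congr 1
      simp only [map_smul, ih, smul_eq_mul, Finset.mul_sum]
      rw [Finset.sum_comm]
      refine Finset.sum_congr rfl fun k _ => ?_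
      rw [Matrix.det_succ_column_zero]
      rfl

/-- Each contraction lowers the degree by one and exchanges the even and odd parts, so each part
vanishes in degrees of the wrong parity. -/
theorem evenChainForm_ιMulti (N : ℕ) {p : ℕ} (f : Fin p → ℕ → K) :
    evenChainForm N (ExteriorAlgebra.ιMulti K p f) =
      if Even p then chainForm N (ExteriorAlgebra.ιMulti K p f) else 0 := by
  suffices h : (Odd p → evenChainForm N (ExteriorAlgebra.ιMulti K p f) = 0) ∧
      (Even p → oddChainForm N (ExteriorAlgebra.ιMulti K p f) = 0) by
    split_ifs with hp
    · simp [chainForm, h.2 hp]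
    · exact h.1 (Nat.not_even_iff_odd.1 hp)
  induction N generalizing p with
  | zero =>
    refine ⟨fun hp => ?_, fun _ => oddChainForm_zero _⟩
    obtain ⟨q, rfl⟩ : ∃ q, p = q + 1 := ⟨p - 1, by have := hp.pos; omega⟩
    rw [ExteriorAlgebra.ιMulti_succ_apply]
    simp [evenChainForm_zero, algebraMapInv_ι]
  | succ N ih =>
    cases p with
    | zero =>
      refine ⟨by simp, fun hp => ?_⟩
      have := (ih f).2 hp
      rw [oddChainForm_succ, this, ExteriorAlgebra.ιMulti_zero_apply, contractLeft_one]
      simp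
    | succ p =>
      rw [evenChainForm_succ, oddChainForm_succ, contractLeft_ιMulti]
      simp only [map_sum, map_smul]
      refine ⟨fun hp => ?_, fun hp => ?_⟩
      · rw [(ih f).1 hp, zero_add]
        refine Finset.sum_eq_zero fun i _ => ?_
        rw [(ih _).2 (by simpa [parity_simps] using hp), smul_zero]
      · rw [(ih f).2 hp, zero_add]
        refine Finset.sum_eq_zero fun i _ => ?_
        rw [(ih _).1 (by simpa [parity_simps] using hp), smul_zero]

end ChainForm

/-! ### Partial fractions with poles in `[-h, h]`. -/

/-- The function `m ↦ 1 / (m + j) ^ s`. -/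
def invPow (s : ℕ) (j m : ℤ) : ℚ := 1 / ((m : ℚ) + j) ^ s

theorem invPow_neg (s : ℕ) (j m : ℤ) : invPow s j (-m) = (-1) ^ s * invPow s (-j) m := by
  have : (((-m : ℤ) : ℚ) + j) = (-1) * ((m : ℚ) + (-j : ℤ)) := by push_cast; ring
  rw [invPow, invPow, this, mul_pow, one_div, mul_inv, ← inv_pow, one_div]
  norm_num

theorem invPow_add (s : ℕ) (j m i : ℤ) : invPow s j (m + i) = invPow s (j + i) m := by
  rw [invPow, invPow]; push_cast; ring_nf

/-- The integers of absolute value larger than `h`. -/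
abbrev Outer (h : ℕ) := {m : ℤ // (h : ℤ) < |m|}

/-- The rational functions, restricted to `|m| > h`, which vanish at infinity and have poles of
order at most `B` at integers of absolute value at most `h` only. -/
def polarSpan (h B : ℕ) : Submodule ℚ (Outer h → ℚ) :=
  Submodule.span ℚ {f | ∃ (s : ℕ) (j : ℤ), 1 ≤ s ∧ s ≤ B ∧ |j| ≤ h ∧ f = fun m : Outer h => invPow s j m}

theorem invPow_mem_polarSpan {h B s : ℕ} {j : ℤ} (hs : 1 ≤ s) (hB : s ≤ B) (hj : |j| ≤ h) :
    (fun m : Outer h => invPow s j m) ∈ polarSpan h B :=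
  Submodule.subset_span ⟨s, j, hs, hB, hj, rfl⟩

theorem Outer.add_ne_zero {h : ℕ} (m : Outer h) {j : ℤ} (hj : |j| ≤ h) : ((m : ℤ) : ℚ) + j ≠ 0 := by
  intro h0
  have h1 : (m : ℤ) = -j := by
    have : ((m : ℤ) : ℚ) = ((-j : ℤ) : ℚ) := by push_cast; linarith
    exact_mod_cast this
  have := m.2
  rw [h1, abs_neg] at this
  omega

theorem isCoprime_X_add_C {a b : ℚ} (h : a ≠ b) :
    IsCoprime (Polynomial.X + Polynomial.C a) (Polynomial.X + Polynomial.C b) := by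
  have := Polynomial.isCoprime_X_sub_C_of_isUnit_sub (R := ℚ) (a := -a) (b := -b)
    (by rw [isUnit_iff_ne_zero]; contrapose! h; linarith)
  simpa using this

/-- Existence of partial fraction decompositions. -/
theorem eval_div_prod_mem_polarSpan {h B : ℕ} (S : Finset ℤ) (n : ℤ → ℕ) (hS : ∀ j ∈ S, |j| ≤ h)
    (hn : ∀ j ∈ S, n j ≤ B) (f : Polynomial ℚ) (hf : f.natDegree < ∑ j ∈ S, n j) :
    (fun m : Outer h => f.eval ((m : ℤ) : ℚ) / ∏ j ∈ S, (((m : ℤ) : ℚ) + j) ^ n j) ∈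
      polarSpan h B := by
  classical
  have hmon : ∀ i ∈ S, (Polynomial.X + Polynomial.C (i : ℚ)).Monic := fun i _ =>
    Polynomial.monic_X_add_C _
  obtain ⟨q, r, hr, hfr⟩ := Polynomial.eq_quo_mul_prod_pow_add_sum_rem_mul_prod_pow (R := ℚ)
    (s := S) f (g := fun j : ℤ => Polynomial.X + Polynomial.C (j : ℚ)) hmon
    (fun i _ j _ hij => isCoprime_X_add_C (by exact_mod_cast hij)) n
  set W : Polynomial ℚ := ∏ i ∈ S, (Polynomial.X + Polynomial.C (i : ℚ)) ^ n i with hW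
  have hWm : W.Monic := Polynomial.monic_prod_of_monic _ _ fun i hi => (hmon i hi).pow _
  have hdeg (T : Finset ℤ) :
      (∏ i ∈ T, (Polynomial.X + Polynomial.C (i : ℚ)) ^ n i).natDegree = ∑ i ∈ T, n i := by
    rw [Polynomial.natDegree_prod_of_monic _ _ fun i _ => (Polynomial.monic_X_add_C _).pow _]
    simp only [Polynomial.natDegree_pow, Polynomial.natDegree_X_add_C, mul_one]
  have hWd : W.degree = ((∑ j ∈ S, n j : ℕ) : WithBot ℕ) := by
    rw [Polynomial.degree_eq_natDegree hWm.ne_zero, hdeg]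
  set rem : Polynomial ℚ := ∑ i ∈ S, ∑ j, r i j * (Polynomial.X + Polynomial.C (i : ℚ)) ^ j.1 *
    ∏ k ∈ S.erase i, (Polynomial.X + Polynomial.C (k : ℚ)) ^ n k with hrem
  -- Remainders modulo a linear polynomial are constants.
  have hc : ∀ i ∈ S, ∀ j, r i j = Polynomial.C ((r i j).coeff 0) := fun i hi j => by
    have := hr i hi j
    rw [Polynomial.degree_X_add_C] at this
    exact Polynomial.eq_C_of_degree_le_zero (Nat.WithBot.lt_one_iff_le_zero.1 this)
  have hremd : rem.degree < W.degree := by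
    rw [hWd, ← Polynomial.mem_degreeLT]
    refine Submodule.sum_mem _ fun i hi => Submodule.sum_mem _ fun j _ => ?_
    rw [Polynomial.mem_degreeLT]
    refine Polynomial.degree_le_natDegree.trans_lt ?_
    rw [hc i hi j]
    have h1 := Polynomial.natDegree_mul_le (p := Polynomial.C ((r i j).coeff 0) *
      (Polynomial.X + Polynomial.C (i : ℚ)) ^ j.1)
      (q := ∏ k ∈ S.erase i, (Polynomial.X + Polynomial.C (k : ℚ)) ^ n k)
    have h2 := Polynomial.natDegree_C_mul_le ((r i j).coeff 0)
      ((Polynomial.X + Polynomial.C (i : ℚ)) ^ j.1)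
    have h3 : ((Polynomial.X + Polynomial.C (i : ℚ)) ^ j.1).natDegree = j.1 := by
      rw [Polynomial.natDegree_pow, Polynomial.natDegree_X_add_C, mul_one]
    rw [hdeg] at h1
    have h4 := Finset.add_sum_erase S n hi
    have h5 := j.2
    exact_mod_cast (by omega)
  -- The polynomial part is the quotient of `f` by the full denominator, and `f` has smaller degree.
  have hq : q = 0 := by
    have h1 := (Polynomial.div_modByMonic_unique (f := f) (g := W) q rem hWm
      ⟨by rw [hfr]; ring, hremd⟩).1
    rw [← h1, Polynomial.divByMonic_eq_zero_iff hWm, hWd]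
    exact Polynomial.degree_le_natDegree.trans_lt (by exact_mod_cast hf)
  have hfun : (fun m : Outer h => f.eval ((m : ℤ) : ℚ) / ∏ j ∈ S, (((m : ℤ) : ℚ) + j) ^ n j) =
      ∑ i ∈ S, ∑ j : Fin (n i), (r i j).coeff 0 • fun m : Outer h => invPow (n i - j) i m := by
    funext m
    have hP : ∀ T ⊆ S, ∏ j ∈ T, (((m : ℤ) : ℚ) + j) ^ n j ≠ 0 := fun T hT =>
      Finset.prod_ne_zero_iff.2 fun j hj => pow_ne_zero _ (m.add_ne_zero (hS j (hT hj)))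
    rw [hfr, hq, zero_mul, zero_add, hrem, Polynomial.eval_finsetSum, Finset.sum_div,
      Finset.sum_apply]
    refine Finset.sum_congr rfl fun i hi => ?_
    rw [Polynomial.eval_finsetSum, Finset.sum_div, Finset.sum_apply]
    refine Finset.sum_congr rfl fun j _ => ?_
    rw [hc i hi j, Polynomial.eval_mul, Polynomial.eval_mul, Polynomial.eval_prod,
      ← Finset.mul_prod_erase S _ hi]
    simp only [Polynomial.eval_pow, Polynomial.eval_add, Polynomial.eval_X, Polynomial.eval_C,
      Pi.smul_apply, smul_eq_mul, invPow, Polynomial.coeff_C_zero]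
    rw [mul_div_mul_right _ _ (hP _ (Finset.erase_subset _ _)), mul_div_assoc]
    congr 1
    have h0 := m.add_ne_zero (hS i hi)
    rw [div_eq_div_iff (pow_ne_zero _ h0) (pow_ne_zero _ h0), one_mul, ← pow_add]
    congr 1
    have := j.2
    omega
  rw [hfun]
  refine Submodule.sum_mem _ fun i hi => Submodule.sum_mem _ fun j _ => Submodule.smul_mem _ _ ?_
  exact invPow_mem_polarSpan (by have := j.2; omega) (by have := hn i hi; omega) (hS i hi)

theorem polarSpan_mono {h B C : ℕ} (hBC : B ≤ C) : polarSpan h B ≤ polarSpan h C :=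
  Submodule.span_mono fun _ ⟨s, j, h1, h2, h3, h4⟩ => ⟨s, j, h1, h2.trans hBC, h3, h4⟩

/-- On generators: equal poles add their orders, while distinct poles are separated by partial
fractions without raising either order. -/
theorem mul_mem_polarSpan {h B C : ℕ} {f g : Outer h → ℚ} (hf : f ∈ polarSpan h B)
    (hg : g ∈ polarSpan h C) : f * g ∈ polarSpan h (B + C) := by
  suffices hle : polarSpan h B * polarSpan h C ≤ polarSpan h (B + C) from
    hle (Submodule.mul_mem_mul hf hg)
  rw [polarSpan, polarSpan, Submodule.span_mul_span, Submodule.span_le]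
  rintro _ ⟨_, ⟨s, i, hs, hsB, hi, rfl⟩, _, ⟨t, j, ht, htC, hj, rfl⟩, rfl⟩
  rcases eq_or_ne i j with rfl | hij
  · have : (fun m : Outer h => invPow s i m) * (fun m : Outer h => invPow t i m) =
        fun m : Outer h => invPow (s + t) i m := by
      funext m
      simp [invPow, pow_add, mul_comm]
    simp only [this]
    exact invPow_mem_polarSpan (by omega) (by omega) hi
  · have := eval_div_prod_mem_polarSpan (h := h) (B := B + C) {i, j} (fun k => if k = i then s else t)
      (by simp [hi, hj]) (by intro k _; split_ifs <;> omega) 1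
      (by rw [Polynomial.natDegree_one, Finset.sum_pair hij]; simp; omega)
    have e : (fun m : Outer h => invPow s i m) * (fun m : Outer h => invPow t j m) =
        fun m : Outer h => (1 : Polynomial ℚ).eval ((m : ℤ) : ℚ) /
          ∏ k ∈ {i, j}, (((m : ℤ) : ℚ) + k) ^ (if k = i then s else t) := by
      funext m
      rw [Finset.prod_pair hij]
      simp [invPow, hij.symm, mul_comm]
    simp only [e]
    exact this

/-! ### Odd parts of shifted poles and their telescoping. -/

/-- The truncated odd part `(f m - f (-m)) / 2` for `m > h`, extended by `0`. -/
def oddTrunc (h : ℕ) : (Outer h → ℚ) →ₗ[ℚ] (ℕ → ℚ) where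
  toFun f m := if hm : h < m then (f ⟨m, by simpa using hm⟩ - f ⟨-m, by simpa using hm⟩) / 2 else 0
  map_add' f g := by
    funext m
    by_cases hm : h < m
    · simp only [hm, dite_true, Pi.add_apply]; ring
    · simp [hm]
  map_smul' c f := by
    funext m
    by_cases hm : h < m
    · simp only [hm, dite_true, Pi.smul_apply, smul_eq_mul, RingHom.id_apply]; ring
    · simp [hm]

/-- The odd part of `1 / (m + j) ^ s`, truncated to `m > h`. -/
def oddPole (h s : ℕ) (j : ℤ) (m : ℕ) : ℚ :=
  if h < m then (invPow s j m - invPow s j (-m)) / 2 else 0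

/-- The sequence `1 / m ^ s`. -/
def pole (s m : ℕ) : ℚ := 1 / (m : ℚ) ^ s

/-- The coefficient of `pole s` in the oddPole family: `1` if `s` is odd and `0` otherwise. -/
def oddCoeff (s : ℕ) : ℚ := if Odd s then 1 else 0

theorem oddTrunc_invPow (h s : ℕ) (j : ℤ) :
    oddTrunc h (fun m : Outer h => invPow s j m) = oddPole h s j := by
  funext m
  simp [oddTrunc, oddPole]

theorem oddPole_neg (h s : ℕ) (j : ℤ) (m : ℕ) :
    oddPole h s (-j) m = -(-1) ^ s * oddPole h s j m := by
  unfold oddPole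
  split_ifs
  · rw [invPow_neg, invPow_neg, neg_neg]
    have : ((-1 : ℚ) ^ s) * (-1) ^ s = 1 := by rw [← mul_pow]; norm_num
    linear_combination (-(invPow s (-j) m) / 2) * this
  · simp

theorem powBound_invPow {s : ℕ} (hs : 1 ≤ s) (j : ℤ) :
    PowBound (-1) fun N : ℕ => ((invPow s j N : ℚ) : ℝ) := by
  have h2 := PowBound.inv_natCast.const_mul 2
  intro ε hε
  refine IsBigO.trans (IsBigO.of_bound 1 ?_) (h2 ε hε)
  -- This threshold ensures `N + j ≥ N / 2 ≥ 1`.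
  filter_upwards [eventually_ge_atTop (2 * j.natAbs + 2)] with N hN
  have hj : |(j : ℝ)| = j.natAbs := by rw [← Int.cast_abs, Int.abs_eq_natAbs]; simp
  have hN' : 2 * |(j : ℝ)| + 2 ≤ N := by rw [hj]; exact_mod_cast hN
  have h3 : (N : ℝ) / 2 ≤ N + j := by linarith [neg_abs_le (j : ℝ), abs_nonneg (j : ℝ)]
  have h4 : (1 : ℝ) ≤ N / 2 := by linarith [abs_nonneg (j : ℝ)]
  have h5 : (1 : ℝ) ≤ N + j := h4.trans h3
  have h6 : (N : ℝ) / 2 ≤ ((N : ℝ) + j) ^ s := h3.trans (le_self_pow₀ h5 (by omega))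
  rw [one_mul, Real.norm_of_nonneg (by positivity : (0 : ℝ) ≤ 2 * (1 / N))]
  have h7 : ((invPow s j N : ℚ) : ℝ) = 1 / ((N : ℝ) + j) ^ s := by simp [invPow]
  have h9 : 0 < ((N : ℝ) + j) ^ s := pow_pos (by linarith) s
  rw [h7, Real.norm_of_nonneg (one_div_nonneg.2 h9.le), div_le_iff₀ h9]
  have h8 : (0 : ℝ) < N := by linarith
  calc (1 : ℝ) = 2 * (1 / N) * (N / 2) := by field_simp
    _ ≤ _ := mul_le_mul_of_nonneg_left h6 (by positivity)

/-- The data of a telescoping comparison between `oddPole h s j` and `oddCoeff s • pole s`. -/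
structure IsTelescoper (h s : ℕ) (j : ℤ) (u : ℕ → ℚ) : Prop where
  telescopes : ∀ m, 1 ≤ m → oddPole h s j m = oddCoeff s * pole s m + (u (m + 1) - u m)
  small : PowBound (-1) fun N => ((u (N + 1) : ℚ) : ℝ)
  even : ∃ V : Outer h → ℚ, V ∈ polarSpan h s ∧ (∀ m m' : Outer h, (m' : ℤ) = -m → V m' = V m) ∧
    ∀ m : Outer h, ∀ k : ℕ, (m : ℤ) = k → V m = u k + u (k + 1)

theorem oddCoeff_eq (s m : ℕ) :
    (invPow s 0 m - invPow s 0 (-m)) / 2 = oddCoeff s * pole s m := by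
  rw [invPow_neg, neg_zero, oddCoeff]
  rcases Nat.even_or_odd s with hs | hs
  · simp [hs.neg_one_pow, Nat.not_odd_iff_even.2 hs]
  · simp [hs.neg_one_pow, hs, invPow, pole]

/-- Passing from pole `0` to pole `j` takes `j` unit steps, each one a difference in `m`; the sum of
these steps is `U`. -/
theorem exists_isTelescoper_natCast {h s : ℕ} (hs : 1 ≤ s) {j : ℕ} (hj : j ≤ h) :
    ∃ u, IsTelescoper h s j u := by
  -- Each summand is invariant under `m ↦ 1 - m`, so `U (1 - m) = U m`; this is what makes `U m + U
  -- (m + 1)` even.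
  set U : ℤ → ℚ := fun m => ∑ i ∈ Finset.range j, (invPow s i m + invPow s i (1 - m)) / 2 with hU
  have hstep (m : ℤ) : U (m + 1) - U m =
      (invPow s j m - invPow s j (-m)) / 2 - (invPow s 0 m - invPow s 0 (-m)) / 2 := by
    have := Finset.sum_range_sub (fun i : ℕ => (invPow s i m - invPow s i (-m)) / 2) j
    simp only [Nat.cast_zero] at this
    rw [← this, hU]
    simp only
    rw [← Finset.sum_sub_distrib]
    refine Finset.sum_congr rfl fun i _ => ?_
    have h1 : (1 : ℤ) - (m + 1) = -m := by ring
    have h2 : (1 : ℤ) - m = -m + 1 := by ring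
    rw [h1, h2, invPow_add, invPow_add]
    push_cast
    ring
  -- For `m ≤ h` the truncated odd part is `0`, so `u` is continued downwards from `U (h + 1)` with
  -- increments that cancel `oddCoeff s * pole s m`.
  refine ⟨fun m => if h < m then U m
    else U (h + 1 : ℕ) + ∑ l ∈ Finset.Ico m (h + 1), oddCoeff s * pole s l, ?_, ?_, ?_⟩
  · intro m hm
    rcases lt_trichotomy m h with hlt | rfl | hgt
    · rw [if_neg (by omega), if_neg (by omega), Finset.sum_eq_sum_Ico_succ_bot (a := m) (by omega),
        oddPole, if_neg (by omega)]
      ring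
    · rw [if_pos (by omega), if_neg (by omega), oddPole, if_neg (by omega)]
      simp
    · rw [if_pos (by omega), if_pos hgt, oddPole, if_pos hgt]
      have := hstep m
      rw [← oddCoeff_eq]
      push_cast
      linarith
  · have h1 : PowBound (-1) fun N : ℕ => ((U N : ℚ) : ℝ) := by
      have : ∀ T : Finset ℕ, PowBound (-1) fun N : ℕ =>
          ((∑ i ∈ T, (invPow s i N + invPow s i (1 - N)) / 2 : ℚ) : ℝ) := by
        intro T
        induction T using Finset.induction_on with
        | empty => simpa using PowBound.zero (-1)
        | insert a T ha ih =>
          have h2 := powBound_invPow hs a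
          have h3 := (powBound_invPow hs (-(a + 1))).const_mul ((-1) ^ s)
          refine (((h2.add h3).const_mul (1 / 2)).add ih).congr' (Eventually.of_forall fun N => ?_)
          have h4 : (1 : ℤ) - N = -N + 1 := by ring
          simp only [Finset.sum_insert ha]
          rw [h4, invPow_add, invPow_neg s ((a : ℤ) + 1)]
          push_cast
          ring
      exact this _
    refine h1.succ.congr' ?_
    filter_upwards [eventually_ge_atTop h] with N hN
    rw [if_pos (by omega)]
  · refine ⟨fun m => U m + U ((m : ℤ) + 1), ?_, ?_, ?_⟩
    · have : (fun m : Outer h => U m + U ((m : ℤ) + 1)) = ∑ i ∈ Finset.range j, (1 / 2 : ℚ) •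
          ((fun m : Outer h => invPow s i m) + (fun m : Outer h => invPow s (i + 1) m) +
            (-1 : ℚ) ^ s • ((fun m : Outer h => invPow s (-i) m) +
              (fun m : Outer h => invPow s (-(i + 1)) m))) := by
        funext m
        rw [hU, Finset.sum_apply]
        simp only
        rw [← Finset.sum_add_distrib]
        refine Finset.sum_congr rfl fun i _ => ?_
        have h1 : (1 : ℤ) - (m + 1) = -m := by ring
        have h2 : (1 : ℤ) - m = -m + 1 := by ring
        rw [h1, h2, invPow_add, invPow_add, invPow_neg, invPow_neg]
        simp only [Pi.smul_apply, Pi.add_apply, smul_eq_mul]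
        ring
      rw [this]
      refine Submodule.sum_mem _ fun i hi => Submodule.smul_mem _ _ ?_
      have hi' := Finset.mem_range.1 hi
      refine Submodule.add_mem _ (Submodule.add_mem _ ?_ ?_)
        (Submodule.smul_mem _ _ (Submodule.add_mem _ ?_ ?_)) <;>
      exact invPow_mem_polarSpan hs le_rfl (by rw [abs_le]; constructor <;> omega)
    · intro m m' hm
      simp only [hU, hm, ← Finset.sum_add_distrib]
      refine Finset.sum_congr rfl fun i _ => ?_
      have h1 : (1 : ℤ) - -m = m + 1 := by ring
      have h2 : (1 : ℤ) - (-m + 1) = m := by ring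
      have h3 : (1 : ℤ) - (m + 1) = -m := by ring
      have h4 : (-m : ℤ) + 1 = 1 - m := by ring
      rw [h1, h2, h3, h4]
      ring
    · intro m k hk
      have h1 : h < k := by have := m.2; rw [hk] at this; simpa using this
      beta_reduce
      rw [if_pos h1, if_pos (by omega), hk]
      push_cast
      ring

theorem exists_isTelescoper {h s : ℕ} (hs : 1 ≤ s) {j : ℤ} (hj : |j| ≤ h) :
    ∃ u, IsTelescoper h s j u := by
  obtain ⟨k, rfl | rfl⟩ := j.eq_nat_or_neg
  · exact exists_isTelescoper_natCast hs (by simpa using hj)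
  · obtain ⟨u, h1, h2, V, h3, h4, h5⟩ :=
      exists_isTelescoper_natCast (h := h) hs (j := k) (by simpa using hj)
    -- Reflecting `j` multiplies the odd part by `-(-1) ^ s`, which is `1` for odd `s`; for even `s`
    -- the coefficient vanishes.
    have hc : -(-1 : ℚ) ^ s * oddCoeff s = oddCoeff s := by
      unfold oddCoeff
      split_ifs with hs
      · simp [hs.neg_one_pow]
      · simp
    refine ⟨fun m => -(-1) ^ s * u m, fun m hm => ?_, ?_, ⟨(-(-1 : ℚ) ^ s) • V,
      Submodule.smul_mem _ _ h3, fun m m' hm => ?_, fun m k hk => ?_⟩⟩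
    · rw [oddPole_neg, h1 m hm]
      linear_combination (pole s m) * hc
    · refine (h2.const_mul (-(-1) ^ s)).congr' (Eventually.of_forall fun N => ?_)
      push_cast; ring
    · simp [h4 m m' hm]
    · simp only [Pi.smul_apply, smul_eq_mul, h5 m k hk]; ring

/-! ### Regularized values in rational subspaces; sums of odd functions. -/

/-- `u` has a harmonic expansion with constant term in `M`. -/
def HasRegValueIn (M : Submodule ℚ ℝ) (u : ℕ → ℝ) : Prop := ∃ c ∈ M, HasRegValue u c

namespace HasRegValueIn

variable {M M' : Submodule ℚ ℝ} {u v : ℕ → ℝ}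

theorem add (hu : HasRegValueIn M u) (hv : HasRegValueIn M v) :
    HasRegValueIn M fun N => u N + v N := by
  obtain ⟨c, hc, h⟩ := hu
  obtain ⟨d, hd, h'⟩ := hv
  exact ⟨c + d, M.add_mem hc hd, h.add h'⟩

theorem const_mul (a : ℚ) (hu : HasRegValueIn M u) : HasRegValueIn M fun N => (a : ℝ) * u N := by
  obtain ⟨c, hc, h⟩ := hu
  refine ⟨a * c, ?_, h.const_mul a⟩
  rw [← Rat.smul_def]
  exact M.smul_mem a hc

theorem sub (hu : HasRegValueIn M u) (hv : HasRegValueIn M v) :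
    HasRegValueIn M fun N => u N - v N := by
  simpa [sub_eq_add_neg] using hu.add (hv.const_mul (-1))

theorem zero (M : Submodule ℚ ℝ) : HasRegValueIn M fun _ => 0 :=
  ⟨0, M.zero_mem, HasRegValue.const 0⟩

theorem sum {ι : Type*} (s : Finset ι) {u : ι → ℕ → ℝ} (h : ∀ i ∈ s, HasRegValueIn M (u i)) :
    HasRegValueIn M fun N => ∑ i ∈ s, u i N := by
  classical
  induction s using Finset.induction_on with
  | empty => simpa using zero M
  | insert a s ha ih =>
    simp only [Finset.sum_insert ha]
    exact (h a (by simp)).add (ih fun i hi => h i (by simp [hi]))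

theorem mul {M'' : Submodule ℚ ℝ} (hu : HasRegValueIn M u) (hv : HasRegValueIn M' v)
    (h : M * M' ≤ M'') : HasRegValueIn M'' fun N => u N * v N := by
  obtain ⟨c, hc, hc'⟩ := hu
  obtain ⟨d, hd, hd'⟩ := hv
  exact ⟨c * d, h (Submodule.mul_mem_mul hc hd), hc'.mul hd'⟩

theorem shift (hu : HasRegValueIn M u) (k : ℕ) : HasRegValueIn M fun N => u (N + k) := by
  obtain ⟨c, hc, h⟩ := hu
  exact ⟨c, hc, h.shift k⟩

end HasRegValueIn

theorem HasRegValue.congr' {u v : ℕ → ℝ} {c : ℝ} (hu : HasRegValue u c) (h : u =ᶠ[atTop] v) :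
    HasRegValue v c := by
  obtain ⟨Q, hQ, hc⟩ := hu
  exact ⟨Q, PowBound.congr' hQ (h.mono fun N hN => by simp only [hN]), hc⟩

theorem HasRegValueIn.congr' {M : Submodule ℚ ℝ} {u v : ℕ → ℝ} (hu : HasRegValueIn M u)
    (h : u =ᶠ[atTop] v) : HasRegValueIn M v := by
  obtain ⟨c, hc, h'⟩ := hu
  exact ⟨c, hc, h'.congr' h⟩

theorem HasRegValueIn.congr {M : Submodule ℚ ℝ} {u v : ℕ → ℝ} (hu : HasRegValueIn M u)
    (h : ∀ N, u N = v N) : HasRegValueIn M v := hu.congr' (Eventually.of_forall h)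

/-- The rational span of `1` and of the numbers `ζ_*(r)` for `r ≤ B` odd. -/
noncomputable def oddZetaSpan (B : ℕ) : Submodule ℚ ℝ :=
  Submodule.span ℚ ({1} ∪ {x | ∃ r : ℕ, Odd r ∧ r ≤ B ∧ x = regMZV ![r]})

theorem ratCast_mem_oddZetaSpan (B : ℕ) (a : ℚ) : (a : ℝ) ∈ oddZetaSpan B := by
  have : (a : ℝ) = a • (1 : ℝ) := by rw [Rat.smul_def, mul_one]
  rw [this]
  exact Submodule.smul_mem _ _ (Submodule.subset_span (Or.inl rfl))

theorem hasRegValueIn_ratCast (B : ℕ) (a : ℚ) : HasRegValueIn (oddZetaSpan B) fun _ => (a : ℝ) :=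
  ⟨a, ratCast_mem_oddZetaSpan B a, HasRegValue.const _⟩

theorem partialSum_pole (s N : ℕ) :
    ((partialSum ℚ N (pole s) : ℚ) : ℝ) = truncatedMZV ![s] N := by
  rw [truncatedMZV_one]
  induction N with
  | zero => simp
  | succ N ih =>
    rw [partialSum_succ_apply, Finset.sum_range_succ, Rat.cast_add, ih]
    simp [pole]

theorem partialSum_congr {f g : ℕ → ℚ} (h : ∀ m, 1 ≤ m → f m = g m) (N : ℕ) :
    partialSum ℚ N f = partialSum ℚ N g := by
  induction N with
  | zero => simp
  | succ N ih => rw [partialSum_succ_apply, partialSum_succ_apply, ih, h _ (by omega)]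

theorem partialSum_sub_shift (u : ℕ → ℚ) (N : ℕ) :
    partialSum ℚ N (fun m => u (m + 1) - u m) = u (N + 1) - u 1 := by
  induction N with
  | zero => simp
  | succ N ih => rw [partialSum_succ_apply, ih]; ring

theorem hasRegValueIn_partialSum_pole {s B : ℕ} (hs : Odd s) (hB : s ≤ B) :
    HasRegValueIn (oddZetaSpan B) fun N => ((partialSum ℚ N (pole s) : ℚ) : ℝ) := by
  simp only [partialSum_pole]
  exact ⟨_, Submodule.subset_span (Or.inr ⟨s, hs, hB, rfl⟩),
    hasRegValue_truncatedMZV _ (Fin.forall_fin_one.2 hs.pos)⟩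

/-- The difference telescopes to `u (N + 1) - u 1`, with `u (N + 1)` negligible and `u 1` rational.
-/
theorem exists_hasRegValue_partialSum_oddPole_sub {h s : ℕ} {j : ℤ} (hs : 1 ≤ s) (hj : |j| ≤ h) :
    ∃ a : ℚ, HasRegValue (fun N => ((partialSum ℚ N (oddPole h s j) : ℚ) : ℝ) -
      ((partialSum ℚ N (oddCoeff s • pole s) : ℚ) : ℝ)) a := by
  obtain ⟨u, hu⟩ := exists_isTelescoper (h := h) hs hj
  refine ⟨-u 1, HasRegValue.of_negligible
    (hu.small.congr' (Eventually.of_forall fun N => ?_))⟩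
  have key : partialSum ℚ N (oddPole h s j) =
      partialSum ℚ N (oddCoeff s • pole s) + (u (N + 1) - u 1) := by
    rw [← partialSum_sub_shift, ← map_add]
    exact partialSum_congr hu.telescopes N
  beta_reduce
  rw [key]
  push_cast
  ring

theorem hasRegValueIn_partialSum_oddPole {h s B : ℕ} {j : ℤ} (hs : 1 ≤ s) (hB : s ≤ B)
    (hj : |j| ≤ h) :
    HasRegValueIn (oddZetaSpan B) fun N => ((partialSum ℚ N (oddPole h s j) : ℚ) : ℝ) := by
  obtain ⟨a, ha⟩ := exists_hasRegValue_partialSum_oddPole_sub (h := h) hs hj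
  have h1 : HasRegValueIn (oddZetaSpan B) fun N =>
      (oddCoeff s : ℝ) * ((partialSum ℚ N (pole s) : ℚ) : ℝ) := by
    by_cases h : Odd s
    · exact (hasRegValueIn_partialSum_pole h hB).const_mul _
    · simpa [oddCoeff, h] using HasRegValueIn.zero _
  refine (h1.add ⟨_, ratCast_mem_oddZetaSpan B a, ha⟩).congr fun N => ?_
  rw [map_smul, smul_eq_mul]
  push_cast
  ring

/-- An odd function equals its odd part, and the odd part of a pole of even order sums to a rational
value. The values of `v` at `m ≤ h` are arbitrary and contribute a rational constant. -/
theorem hasRegValueIn_partialSum_of_odd {h B : ℕ} {w : Outer h → ℚ} (hw : w ∈ polarSpan h B)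
    (hodd : ∀ m m' : Outer h, (m' : ℤ) = -m → w m' = -w m) {v : ℕ → ℚ}
    (hv : ∀ m : Outer h, ∀ k : ℕ, (m : ℤ) = k → v k = w m) :
    HasRegValueIn (oddZetaSpan B) fun N => ((partialSum ℚ N v : ℚ) : ℝ) := by
  have h1 : HasRegValueIn (oddZetaSpan B) fun N =>
      ((partialSum ℚ N (oddTrunc h w) : ℚ) : ℝ) := by
    clear hodd hv
    induction hw using Submodule.span_induction with
    | mem f hf =>
      obtain ⟨s, j, h1, h2, h3, rfl⟩ := hf
      rw [oddTrunc_invPow]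
      exact hasRegValueIn_partialSum_oddPole h1 h2 h3
    | zero => simpa using HasRegValueIn.zero _
    | add f g _ _ hf hg =>
      refine (hf.add hg).congr fun N => ?_
      rw [map_add, map_add]; push_cast; rfl
    | smul a f _ hf =>
      refine (hf.const_mul a).congr fun N => ?_
      rw [map_smul, map_smul, smul_eq_mul]; push_cast; rfl
  have h2 (k : ℕ) : partialSum ℚ (h + k) v = partialSum ℚ (h + k) (oddTrunc h w) +
      (partialSum ℚ h v - partialSum ℚ h (oddTrunc h w)) := by
    induction k with
    | zero => simp
    | succ k ih =>
      rw [← add_assoc, partialSum_succ_apply, partialSum_succ_apply, ih]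
      have hk : (h : ℤ) < |((h + k + 1 : ℕ) : ℤ)| := by rw [Nat.abs_cast]; omega
      have hk' : (h : ℤ) < |-((h + k + 1 : ℕ) : ℤ)| := by rwa [abs_neg]
      have h3 : oddTrunc h w (h + k + 1) = w ⟨_, hk⟩ := by
        have := hodd ⟨_, hk⟩ ⟨_, hk'⟩ rfl
        simp only [oddTrunc, LinearMap.coe_mk, AddHom.coe_mk]
        rw [dif_pos (by omega), this]
        ring
      rw [h3, hv ⟨_, hk⟩ _ rfl]
      ring
  refine (h1.add (hasRegValueIn_ratCast B
    (partialSum ℚ h v - partialSum ℚ h (oddTrunc h w)))).congr' ?_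
  filter_upwards [eventually_ge_atTop h] with N hN
  obtain ⟨k, rfl⟩ := Nat.exists_eq_add_of_le hN
  rw [h2]
  push_cast
  rfl

/-! ### Effect of telescoping on pair sums. -/

/-- Summation by parts: summing `u (m + 1) - u m` over the indices above and below that of `g` gives
`u (N + 1) - u (m + 1)` and `u m - u 1`, which enter with opposite signs. -/
theorem pairSum_of_telescopes {f f' u : ℕ → ℚ} (h : ∀ m, 1 ≤ m → f m = f' m + (u (m + 1) - u m))
    (g : ℕ → ℚ) (N : ℕ) :
    pairSum f N g = pairSum f' N g + (u (N + 1) + u 1) * partialSum ℚ N g -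
      partialSum ℚ N (fun m => g m * (u m + u (m + 1))) := by
  have hE (N : ℕ) : partialSum ℚ N f = partialSum ℚ N f' + (u (N + 1) - u 1) := by
    rw [← partialSum_sub_shift, ← map_add]
    exact partialSum_congr h N
  induction N with
  | zero => simp
  | succ N ih =>
    rw [pairSum_succ_apply, pairSum_succ_apply, ih, partialSum_succ_apply, partialSum_succ_apply,
      hE, h (N + 1) (by omega)]
    ring

/-- `g` is odd and `u m + u (m + 1)` is even, so their product is an odd function with poles of
order at most `s + t`; its sum involves only odd zeta values. -/
theorem hasRegValueIn_pairSum_sub {h s t B : ℕ} {j : ℤ} (hs : 1 ≤ s) (hj : |j| ≤ h) (ht : 1 ≤ t)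
    (hB : s + t ≤ B) {g : ℕ → ℚ}
    (hg : (Odd t ∧ g = pole t) ∨ ∃ l : ℤ, |l| ≤ h ∧ g = oddPole h t l) :
    HasRegValueIn (oddZetaSpan B) fun N =>
      ((pairSum (oddPole h s j) N g : ℚ) : ℝ) - ((pairSum (oddCoeff s • pole s) N g : ℚ) : ℝ) := by
  obtain ⟨u, hu⟩ := exists_isTelescoper (h := h) hs hj
  obtain ⟨V, hV, hVe, hVu⟩ := hu.even
  have hgs : HasRegValueIn (oddZetaSpan B) fun N => ((partialSum ℚ N g : ℚ) : ℝ) := by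
    rcases hg with ⟨hodd, rfl⟩ | ⟨l, hl, rfl⟩
    · exact hasRegValueIn_partialSum_pole hodd (by omega)
    · exact hasRegValueIn_partialSum_oddPole ht (by omega) hl
  obtain ⟨w, hw, hwo, hwg⟩ : ∃ w ∈ polarSpan h t, (∀ m m' : Outer h, (m' : ℤ) = -m → w m' = -w m) ∧
      ∀ m : Outer h, ∀ k : ℕ, (m : ℤ) = k → g k = w m := by
    rcases hg with ⟨hodd, rfl⟩ | ⟨l, hl, rfl⟩
    · refine ⟨_, invPow_mem_polarSpan (j := 0) ht le_rfl (by simp), fun m m' hm => ?_,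
        fun m k hk => ?_⟩
      · rw [hm, invPow_neg, hodd.neg_one_pow]; simp
      · simp [hk, pole, invPow]
    · refine ⟨(1 / 2 : ℚ) • ((fun m : Outer h => invPow t l m) - (-1 : ℚ) ^ t •
        (fun m : Outer h => invPow t (-l) m)), Submodule.smul_mem _ _ (Submodule.sub_mem _
        (invPow_mem_polarSpan ht le_rfl hl) (Submodule.smul_mem _ _
        (invPow_mem_polarSpan ht le_rfl (by rwa [abs_neg])))), fun m m' hm => ?_,
        fun m k hk => ?_⟩
      · simp only [Pi.smul_apply, Pi.sub_apply, smul_eq_mul, hm, ← invPow_neg, neg_neg]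
        ring
      · have hk' : h < k := by have := m.2; rw [hk] at this; simpa using this
        simp only [Pi.smul_apply, Pi.sub_apply, smul_eq_mul, hk, ← invPow_neg, oddPole, if_pos hk']
        ring
  have h1 : HasRegValueIn (oddZetaSpan B) fun N =>
      ((partialSum ℚ N (fun m => g m * (u m + u (m + 1))) : ℚ) : ℝ) := by
    refine hasRegValueIn_partialSum_of_odd (w := w * V)
      (polarSpan_mono (by omega) (mul_mem_polarSpan hw hV)) (fun m m' hm => ?_) fun m k hk => ?_
    · simp [hwo m m' hm, hVe m m' hm]
    · simp [hwg m k hk, hVu m k hk]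
  have h2 : HasRegValueIn (oddZetaSpan B) fun N =>
      ((u (N + 1) + u 1 : ℚ) : ℝ) * ((partialSum ℚ N g : ℚ) : ℝ) := by
    obtain ⟨c, hc, hc'⟩ := hgs
    refine ⟨(u 1 : ℝ) * c, ?_, HasRegValue.mul (HasRegValue.of_negligible
      (hu.small.congr' (Eventually.of_forall fun N => by push_cast; ring))) hc'⟩
    rw [← Rat.smul_def]
    exact Submodule.smul_mem _ _ hc
  refine (h2.sub h1).congr fun N => ?_
  rw [pairSum_of_telescopes (f' := oddCoeff s • pole s) (u := u) (fun m hm => hu.telescopes m hm)]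
  push_cast
  ring

theorem admissibleProducts_mono {A p p' : ℕ} (h : p ≤ p') :
    admissibleProducts A p ⊆ admissibleProducts A p' :=
  fun _ ⟨q, q', s, s', h1, h2⟩ => ⟨q, q', s, s', h1.trans h, h2⟩

/-- A new factor `ζ_*(r)` raises `q` by one and hence `2q + q'` by two; an odd `r ≤ 2A` satisfies `r
≤ 2A - 1`. -/
theorem oddZetaSpan_mul_admissible_le (A p : ℕ) :
    oddZetaSpan (2 * A) * Submodule.span ℚ (admissibleProducts A p) ≤
      Submodule.span ℚ (admissibleProducts A (p + 2)) := by
  rw [oddZetaSpan, Submodule.span_mul_span]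
  refine Submodule.span_mono ?_
  rintro _ ⟨x, hx, y, ⟨q, q', s, s', h1, h2, h3, rfl⟩, rfl⟩
  rcases hx with rfl | ⟨r, hr, hrA, rfl⟩
  · exact ⟨q, q', s, s', by omega, h2, h3, by simp⟩
  · refine ⟨q + 1, q', Fin.cons r s, s', by omega, ?_, h3, ?_⟩
    · refine Fin.cases ⟨hr, hr.pos, ?_⟩ h2
      obtain ⟨t, rfl⟩ := hr
      simp only [Fin.cons_zero]
      omega
    · rw [Fin.prod_univ_succ]
      simp [mul_assoc]

/-! ### Removing the shifts entry by entry. -/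

/-- The sequence encoded by an exponent `s` and an optional shift `j`: `1 / m ^ s` when there is no
shift, and the truncated odd part of `1 / (m + j) ^ s` otherwise. -/
def entrySeq (h : ℕ) : ℕ × Option ℤ → ℕ → ℚ
  | (s, none) => pole s
  | (s, some j) => oddPole h s j

/-- The condition on an entry that its exponent lies in `[1, A]`, that it is odd when there is no
shift, and that the shift is at most `h` otherwise. -/
def IsEntry (h A : ℕ) : ℕ × Option ℤ → Prop
  | (s, none) => 1 ≤ s ∧ s ≤ A ∧ Odd s
  | (s, some j) => 1 ≤ s ∧ s ≤ A ∧ |j| ≤ h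

/-- The Leibniz formula turns the chain form into the antisymmetrized truncated multiple zeta value,
an admissible product with `q = 0`. -/
theorem hasRegValueIn_chainForm_pole (A : ℕ) {p : ℕ} (s : Fin p → ℕ)
    (hs : ∀ i, 1 ≤ s i ∧ s i ≤ A ∧ Odd (s i)) :
    HasRegValueIn (Submodule.span ℚ (admissibleProducts A p)) fun N =>
      ((chainForm N (ExteriorAlgebra.ιMulti ℚ p fun i => pole (s i)) : ℚ) : ℝ) := by
  refine ⟨regAntisymMZV s, Submodule.subset_span ⟨0, p, Fin.elim0, s, by omega, fun i => i.elim0,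
    fun i => ⟨(hs i).2.2, (hs i).1, (hs i).2.1⟩, by simp⟩, ?_⟩
  have h1 : HasRegValue (fun N => ∑ σ : Equiv.Perm (Fin p),
      ((Equiv.Perm.sign σ : ℤ) : ℝ) * truncatedMZV (s ∘ σ) N) (regAntisymMZV s) :=
    HasRegValue.sum _ fun σ _ => (hasRegValue_truncatedMZV _ fun i => (hs (σ i)).1).const_mul _
  refine h1.congr' (Eventually.of_forall fun N => ?_)
  simp only [chainForm_ιMulti, Matrix.det_apply', truncatedMZV_eq_sum, Finset.mul_sum]
  rw [Finset.sum_comm]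
  push_cast
  simp [pole]

theorem hasRegValueIn_pairSum_entrySeq_sub {h A s : ℕ} {j : ℤ} (hs : 1 ≤ s) (hsA : s ≤ A) (hj : |j| ≤ h)
    {x : ℕ × Option ℤ} (hx : IsEntry h A x) :
    HasRegValueIn (oddZetaSpan (2 * A)) fun N =>
      ((pairSum (oddPole h s j) N (entrySeq h x) : ℚ) : ℝ) -
        ((pairSum (oddCoeff s • pole s) N (entrySeq h x) : ℚ) : ℝ) := by
  obtain ⟨t, _ | l⟩ := x
  · exact hasRegValueIn_pairSum_sub hs hj hx.1 (by have := hx.2.1; omega) (Or.inl ⟨hx.2.2, rfl⟩)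
  · exact hasRegValueIn_pairSum_sub hs hj hx.1 (by have := hx.2.1; omega)
      (Or.inr ⟨l, hx.2.2, rfl⟩)

/-- Replacing a truncated odd part by the corresponding multiple of `1 / m ^ s` in one entry. -/
theorem hasRegValueIn_chainForm_ι_oddPole_mul {h A s q : ℕ} {j : ℤ} (hs : 1 ≤ s) (hsA : s ≤ A)
    (hj : |j| ≤ h) (e : Fin q → ℕ × Option ℤ) (he : ∀ i, IsEntry h A (e i))
    (hlt : ∀ p < q + 1, ∀ e : Fin p → ℕ × Option ℤ, (∀ i, IsEntry h A (e i)) →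
      HasRegValueIn (Submodule.span ℚ (admissibleProducts A p)) fun N =>
        ((chainForm N (ExteriorAlgebra.ιMulti ℚ p fun i => entrySeq h (e i)) : ℚ) : ℝ))
    (hpole : Odd s → HasRegValueIn (Submodule.span ℚ (admissibleProducts A (q + 1))) fun N =>
      ((chainForm N (ExteriorAlgebra.ι ℚ (pole s) *
        ExteriorAlgebra.ιMulti ℚ q fun i => entrySeq h (e i)) : ℚ) : ℝ)) :
    HasRegValueIn (Submodule.span ℚ (admissibleProducts A (q + 1))) fun N =>
      ((chainForm N (ExteriorAlgebra.ι ℚ (oddPole h s j) *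
        ExteriorAlgebra.ιMulti ℚ q fun i => entrySeq h (e i)) : ℚ) : ℝ) := by
  have h1 : HasRegValueIn (Submodule.span ℚ (admissibleProducts A (q + 1))) fun N =>
      ((chainForm N (ExteriorAlgebra.ι ℚ (oddCoeff s • pole s) *
        ExteriorAlgebra.ιMulti ℚ q fun i => entrySeq h (e i)) : ℚ) : ℝ) := by
    by_cases hodd : Odd s
    · simpa [oddCoeff, hodd] using hpole hodd
    · simpa [oddCoeff, hodd] using HasRegValueIn.zero _
  -- Border term: a quantity of rational regularized value times a form of length `q`, so no zeta
  -- factor appears.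
  have h2 : HasRegValueIn (Submodule.span ℚ (admissibleProducts A (q + 1))) fun N =>
      (((partialSum ℚ N (oddPole h s j) : ℚ) : ℝ) -
        ((partialSum ℚ N (oddCoeff s • pole s) : ℚ) : ℝ)) *
      ((evenChainForm N (ExteriorAlgebra.ιMulti ℚ q fun i => entrySeq h (e i)) : ℚ) : ℝ) := by
    simp only [evenChainForm_ιMulti]
    split_ifs with hq
    · obtain ⟨a, ha⟩ := exists_hasRegValue_partialSum_oddPole_sub (h := h) hs hj
      obtain ⟨b, hb, hb'⟩ := hlt q (by omega) e he
      refine ⟨a * b, ?_, ha.mul hb'⟩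
      rw [← Rat.smul_def]
      exact Submodule.smul_mem _ _ (Submodule.span_mono (admissibleProducts_mono (by omega)) hb)
    · simpa using HasRegValueIn.zero _
  -- Pair terms: each removes two entries in exchange for an element of `oddZetaSpan (2 * A)`.
  have h3 : HasRegValueIn (Submodule.span ℚ (admissibleProducts A (q + 1))) fun N =>
      ((chainForm N (CliffordAlgebra.contractLeft (pairSum (oddPole h s j) N)
        (ExteriorAlgebra.ιMulti ℚ q fun i => entrySeq h (e i))) : ℚ) : ℝ) -
      ((chainForm N (CliffordAlgebra.contractLeft (pairSum (oddCoeff s • pole s) N)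
        (ExteriorAlgebra.ιMulti ℚ q fun i => entrySeq h (e i))) : ℚ) : ℝ) := by
    cases q with
    | zero =>
      simp only [ExteriorAlgebra.ιMulti_zero_apply, CliffordAlgebra.contractLeft_one]
      simpa using HasRegValueIn.zero _
    | succ q =>
      have h4 : HasRegValueIn (Submodule.span ℚ (admissibleProducts A (q + 1 + 1))) fun N =>
          ∑ i : Fin (q + 1), (((-1) ^ (i : ℕ) : ℚ) : ℝ) *
            ((((pairSum (oddPole h s j) N (entrySeq h (e i)) : ℚ) : ℝ) -
              ((pairSum (oddCoeff s • pole s) N (entrySeq h (e i)) : ℚ) : ℝ)) *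
            ((chainForm N (ExteriorAlgebra.ιMulti ℚ q
              fun k => entrySeq h (e (i.succAbove k))) : ℚ) : ℝ)) :=
        HasRegValueIn.sum _ fun i _ => HasRegValueIn.const_mul _
          ((hasRegValueIn_pairSum_entrySeq_sub hs hsA hj (he i)).mul
            (hlt q (by omega) (fun k => e (i.succAbove k)) fun k => he _)
            (oddZetaSpan_mul_admissible_le A q))
      refine h4.congr fun N => ?_
      rw [contractLeft_ιMulti, contractLeft_ιMulti, map_sum, map_sum, ← Rat.cast_sub,
        ← Finset.sum_sub_distrib, Rat.cast_sum]
      refine Finset.sum_congr rfl fun i _ => ?_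
      simp only [map_smul, smul_eq_mul, Function.comp_def]
      push_cast
      ring
  refine ((h1.add h2).add h3).congr fun N => ?_
  rw [chainForm_ι_mul, chainForm_ι_mul]
  push_cast
  ring

/-- Strong induction on the length, then on the number of shifted entries: replacing one shifted
entry by a pure pole costs only forms of smaller length. -/
theorem hasRegValueIn_chainForm_entrySeq (h A : ℕ) {p : ℕ} (e : Fin p → ℕ × Option ℤ)
    (he : ∀ i, IsEntry h A (e i)) :
    HasRegValueIn (Submodule.span ℚ (admissibleProducts A p)) fun N =>
      ((chainForm N (ExteriorAlgebra.ιMulti ℚ p fun i => entrySeq h (e i)) : ℚ) : ℝ) := by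
  induction p using Nat.strong_induction_on with
  | _ p ihp =>
  induction hc : (Finset.univ.filter fun i => (e i).2.isSome).card generalizing e with
  | zero =>
    have h0 : ∀ i, e i = ((e i).1, none) := fun i => by
      have := Finset.filter_eq_empty_iff.1 (Finset.card_eq_zero.1 hc) (Finset.mem_univ i)
      exact Prod.ext rfl (by simpa using this)
    have := hasRegValueIn_chainForm_pole A (fun i => (e i).1) fun i => by
      have h1 := he i
      rw [h0] at h1
      exact h1
    refine this.congr fun N => ?_
    congr 3
    funext i
    rw [h0 i]
    rfl
  | succ c ihc =>
    obtain ⟨i, hi⟩ : ∃ i, (e i).2.isSome := by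
      obtain ⟨i, hi⟩ := Finset.card_pos.1 (by omega : 0 <
        (Finset.univ.filter fun i => (e i).2.isSome).card)
      exact ⟨i, (Finset.mem_filter.1 hi).2⟩
    obtain ⟨j, hj⟩ := Option.isSome_iff_exists.1 hi
    obtain ⟨q, rfl⟩ : ∃ q, p = q + 1 := ⟨p - 1, by have := i.2; omega⟩
    have hij : e i = ((e i).1, some j) := Prod.ext rfl hj
    have hei := he i
    rw [hij] at hei
    -- A shifted entry is brought to the front, at the price of a sign.
    set σ : Equiv.Perm (Fin (q + 1)) := Equiv.swap 0 i with hσ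
    have hσ0 : σ 0 = i := Equiv.swap_apply_left 0 i
    have h1 := hasRegValueIn_chainForm_ι_oddPole_mul (q := q) hei.1 hei.2.1 hei.2.2
      (fun k => e (σ k.succ)) (fun k => he _) ihp fun hodd => by
        have := ihc (Fin.cons ((e i).1, none) fun k => e (σ k.succ))
          (Fin.cases ⟨hei.1, hei.2.1, hodd⟩ fun k => he _) (by
            have h2 : (Finset.univ.filter fun k => (e (σ k)).2.isSome).card = c + 1 := by
              rw [← hc]
              exact Finset.card_bij (fun k _ => σ k) (by simp) (by simp)
                fun k hk => ⟨σ.symm k, by simpa using hk, by simp⟩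
            rw [Fin.card_filter_univ_succ, if_pos (by simpa [hσ0] using hi)] at h2
            rw [Fin.card_filter_univ_succ, if_neg (by simp)]
            simpa using h2)
        refine this.congr fun N => ?_
        rw [ExteriorAlgebra.ιMulti_succ_apply]
        rfl
    refine (h1.const_mul (Equiv.Perm.sign σ : ℤ)).congr fun N => ?_
    have h2 := AlternatingMap.map_perm (ExteriorAlgebra.ιMulti ℚ (q + 1))
      (fun k => entrySeq h (e (σ k))) σ
    have h3 : ((fun k => entrySeq h (e (σ k))) ∘ σ) = fun k => entrySeq h (e k) := by
      funext k
      simp [hσ]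
    rw [h3] at h2
    rw [h2, ExteriorAlgebra.ιMulti_succ_apply, hσ0, hij, Units.smul_def, ← Int.cast_smul_eq_zsmul ℚ,
      map_smul, smul_eq_mul, Rat.cast_mul]
    rfl

/-! ### Extension to all partial fractions by multilinearity. -/

/-- A predicate on tuples which is closed under linear operations in each entry extends from tuples
with entries in `S` to tuples with entries in the span of `S`. -/
theorem forall_mem_span_of_multilinear {R V : Type*} [CommRing R] [AddCommGroup V] [Module R V]
    {p : ℕ} (S : Set V) (C : (Fin p → V) → Prop)
    (hzero : ∀ v i, C (Function.update v i 0))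
    (hadd : ∀ v i x y, C (Function.update v i x) → C (Function.update v i y) →
      C (Function.update v i (x + y)))
    (hsmul : ∀ v i (a : R) x, C (Function.update v i x) → C (Function.update v i (a • x)))
    (hS : ∀ v, (∀ i, v i ∈ S) → C v) (v : Fin p → V) (hv : ∀ i, v i ∈ Submodule.span R S) : C v := by
  have key : ∀ (T : Finset (Fin p)) (v : Fin p → V), (∀ i ∈ T, v i ∈ Submodule.span R S) →
      (∀ i ∉ T, v i ∈ S) → C v := by
    intro T
    induction T using Finset.induction_on with
    | empty => exact fun v _ h => hS v fun i => h i (by simp)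
    | insert a T ha ih =>
      intro v h1 h2
      have : ∀ x ∈ Submodule.span R S, C (Function.update v a x) := by
        intro x hx
        induction hx using Submodule.span_induction with
        | mem x hx =>
          refine ih _ (fun i hi => ?_) fun i hi => ?_
          · rw [Function.update_of_ne (by rintro rfl; exact ha hi)]
            exact h1 i (by simp [hi])
          · by_cases hia : i = a
            · subst hia; simpa using hx
            · rw [Function.update_of_ne hia]
              exact h2 i (by simp [hia, hi])
        | zero => exact hzero v a
        | add x y _ _ hx hy => exact hadd v a x y hx hy
        | smul c x _ hx => exact hsmul v a c x hx
      simpa using this (v a) (h1 a (by simp))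
  exact key Finset.univ v (fun i _ => hv i) fun i hi => absurd (Finset.mem_univ i) hi

theorem hasRegValueIn_chainForm_oddTrunc {h A p : ℕ} (w : Fin p → Outer h → ℚ)
    (hw : ∀ i, w i ∈ polarSpan h A) :
    HasRegValueIn (Submodule.span ℚ (admissibleProducts A p)) fun N =>
      ((chainForm N (ExteriorAlgebra.ιMulti ℚ p fun i => oddTrunc h (w i)) : ℚ) : ℝ) := by
  have hup (v : Fin p → Outer h → ℚ) (i : Fin p) (x : Outer h → ℚ) :
      (fun k => oddTrunc h (Function.update v i x k)) =
        Function.update (fun k => oddTrunc h (v k)) i (oddTrunc h x) := by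
    funext k
    by_cases hk : k = i
    · subst hk; simp
    · simp [hk]
  refine forall_mem_span_of_multilinear (R := ℚ)
    {f | ∃ (s : ℕ) (j : ℤ), 1 ≤ s ∧ s ≤ A ∧ |j| ≤ h ∧ f = fun m : Outer h => invPow s j m}
    (fun w => HasRegValueIn (Submodule.span ℚ (admissibleProducts A p)) fun N =>
      ((chainForm N (ExteriorAlgebra.ιMulti ℚ p fun i => oddTrunc h (w i)) : ℚ) : ℝ))
    (fun v i => ?_) (fun v i x y hx hy => ?_) (fun v i a x hx => ?_) (fun v hv => ?_) w hw
  · simp only [hup, map_zero, AlternatingMap.map_update_zero]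
    simpa using HasRegValueIn.zero _
  · simp only [hup] at hx hy ⊢
    refine (hx.add hy).congr fun N => ?_
    rw [map_add, AlternatingMap.map_update_add, map_add, Rat.cast_add]
  · simp only [hup] at hx ⊢
    refine (hx.const_mul a).congr fun N => ?_
    rw [map_smul, AlternatingMap.map_update_smul, map_smul, smul_eq_mul, Rat.cast_mul]
  · choose s j hs hsA hj hv using hv
    refine (hasRegValueIn_chainForm_entrySeq h A (fun i => (s i, some (j i)))
      fun i => ⟨hs i, hsA i, hj i⟩).congr fun N => ?_
    congr 3
    funext i
    rw [hv i, oddTrunc_invPow]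
    rfl

/-! ### The centred summand and its symmetries. -/

/-- The function `m ↦ ∏_{|j| ≤ h} (m + j)`. -/
noncomputable def centeredPochhammer (h : ℕ) (m : ℤ) : ℚ := ∏ j ∈ Finset.Icc (-(h : ℤ)) h, ((m : ℚ) + j)

theorem centeredPochhammer_neg (h : ℕ) (m : ℤ) :
    centeredPochhammer h (-m) = -centeredPochhammer h m := by
  have h1 : centeredPochhammer h (-m) =
      ∏ j ∈ Finset.Icc (-(h : ℤ)) h, (-1 : ℚ) * ((m : ℚ) + j) := by
    refine Finset.prod_nbij' (fun j => -j) (fun j => -j) ?_ ?_ ?_ ?_ ?_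
    · intro j hj; rw [Finset.mem_Icc] at hj ⊢; omega
    · intro j hj; rw [Finset.mem_Icc] at hj ⊢; omega
    · simp
    · simp
    · intro j _; push_cast; ring
  rw [h1, Finset.prod_mul_distrib, Finset.prod_const, Int.card_Icc, centeredPochhammer,
    show ((h : ℤ) + 1 - -(h : ℤ)).toNat = 2 * h + 1 by omega, pow_succ, pow_mul]
  simp

theorem ascPochhammer_eval_eq_centeredPochhammer (h k : ℕ) :
    (ascPochhammer ℝ (h + h + 1)).eval (k : ℝ) = ((centeredPochhammer h (k + h) : ℚ) : ℝ) := by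
  have h1 : ∀ n : ℕ, (ascPochhammer ℝ n).eval (k : ℝ) = ∏ i ∈ Finset.range n, ((k : ℝ) + i) := by
    intro n
    induction n with
    | zero => simp
    | succ n ih => rw [ascPochhammer_succ_eval, ih, Finset.prod_range_succ]
  rw [h1, centeredPochhammer, Rat.cast_prod]
  refine Finset.prod_nbij' (fun i => (i : ℤ) - h) (fun j => (j + h).toNat) ?_ ?_ ?_ ?_ ?_
  · intro i hi; rw [Finset.mem_range] at hi; rw [Finset.mem_Icc]; omega
  · intro j hj; rw [Finset.mem_Icc] at hj; rw [Finset.mem_range]; omega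
  · intro i _; simp
  · intro j hj; rw [Finset.mem_Icc] at hj; omega
  · intro i _; push_cast; ring

/-- The summand of the truncated hypergeometric sum in the centered variables `m = k + h`. -/
noncomputable def centeredSummand (h A : ℕ) {p : ℕ} (P : MvPolynomial (Fin p) ℚ) (m : Fin p → ℤ) : ℚ :=
  MvPolynomial.eval (fun i => (m i : ℚ) - h) P / ∏ i, centeredPochhammer h (m i) ^ A

section Symmetry

variable {h A p : ℕ} {P : MvPolynomial (Fin p) ℚ}

theorem centeredSummand_perm (hP : P ∈ symmetryClass (h + h) A p) (σ : Equiv.Perm (Fin p))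
    (m : Fin p → ℤ) :
    centeredSummand h A P (m ∘ σ) = ((Equiv.Perm.sign σ : ℤ) : ℚ) * centeredSummand h A P m := by
  have h1 := congrArg (MvPolynomial.eval fun i => (m i : ℚ) - h) (hP.1 σ)
  rw [MvPolynomial.eval_rename, map_mul, MvPolynomial.eval_C] at h1
  have h2 : ∏ i, centeredPochhammer h ((m ∘ σ) i) ^ A = ∏ i, centeredPochhammer h (m i) ^ A :=
    Equiv.prod_comp σ fun i => centeredPochhammer h (m i) ^ A
  rw [centeredSummand, centeredSummand, h2, mul_div_assoc', ← h1]
  rfl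

theorem centeredSummand_update_neg (hP : P ∈ symmetryClass (h + h) A p) (j : Fin p)
    (m : Fin p → ℤ) :
    centeredSummand h A P (Function.update m j (-m j)) = -centeredSummand h A P m := by
  have h1 := congrArg (MvPolynomial.eval fun i => (m i : ℚ) - h) (hP.2 j)
  rw [map_mul, map_pow, map_neg, map_one, ← MvPolynomial.coe_aeval_eq_eval, RingHom.coe_coe,
    MvPolynomial.aeval_bind₁] at h1
  have h2 : (fun i => MvPolynomial.aeval (fun i => (m i : ℚ) - h)
      (Function.update (MvPolynomial.X : Fin p → MvPolynomial (Fin p) ℚ) j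
        (-MvPolynomial.X j - MvPolynomial.C ((h + h : ℕ) : ℚ)) i)) =
      fun i => ((Function.update m j (-m j) i : ℤ) : ℚ) - h := by
    funext i
    by_cases hi : i = j
    · subst hi
      simp
      ring
    · simp [hi]
  rw [h2] at h1
  have h3 : ∏ i, centeredPochhammer h (Function.update m j (-m j) i) ^ A =
      (-1) ^ A * ∏ i, centeredPochhammer h (m i) ^ A := by
    have h4 : (fun i => centeredPochhammer h (Function.update m j (-m j) i) ^ A) =
        Function.update (fun i => centeredPochhammer h (m i) ^ A) j
          ((-1) ^ A * centeredPochhammer h (m j) ^ A) := by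
      funext i
      by_cases hi : i = j
      · subst hi
        simp [centeredPochhammer_neg, neg_pow (centeredPochhammer h (m i))]
      · simp [hi]
    rw [h4, Finset.prod_update_of_mem (Finset.mem_univ j), mul_assoc,
      ← Finset.prod_mul_prod_compl {j} (fun i => centeredPochhammer h (m i) ^ A)]
    simp [Finset.compl_eq_univ_sdiff]
  -- As `2h + 1` is odd, the numerator's sign is `-(-1) ^ A`; the denominator contributes `(-1) ^
  -- A`, so the quotient is odd.
  have h5 : ((-1 : ℚ)) ^ (A * (h + h + 1) + 1) = -(-1) ^ A := by
    rw [pow_succ, mul_add, pow_add, ← two_mul, mul_left_comm, pow_mul]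
    simp
  rw [h5] at h1
  rw [centeredSummand, centeredSummand, h3, ← MvPolynomial.coe_aeval_eq_eval, RingHom.coe_coe, h1,
    neg_mul, neg_div, mul_div_mul_left _ _ (pow_ne_zero A (by norm_num))]
  rfl

/-- Changing signs of the variables in a set `S` of indices. -/
theorem centeredSummand_neg_on (hP : P ∈ symmetryClass (h + h) A p) (S : Finset (Fin p))
    (m : Fin p → ℤ) :
    centeredSummand h A P (fun i => if i ∈ S then -m i else m i) =
      (-1) ^ S.card * centeredSummand h A P m := by
  induction S using Finset.induction_on with
  | empty => simp
  | insert a S ha ih =>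
    have h1 := centeredSummand_update_neg hP a (fun i => if i ∈ S then -m i else m i)
    rw [ih] at h1
    rw [Finset.card_insert_of_notMem ha, pow_succ, mul_neg_one, neg_mul, ← h1]
    congr 1
    funext i
    by_cases hi : i = a
    · subst hi; simp [ha]
    · simp [hi]

/-- The one-variable factor `(m - h) ^ d / ∏_{|j| ≤ h} (m + j) ^ A`. -/
noncomputable def centeredFactor (h A d : ℕ) (m : ℤ) : ℚ := ((m : ℚ) - h) ^ d / centeredPochhammer h m ^ A

/-- The denominator has degree `A * (2h + 1)`, so the bound on `d` excludes a polynomial part. -/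
theorem centeredFactor_mem_polarSpan {d : ℕ} (hd : d < A * (h + h + 1)) :
    (fun m : Outer h => centeredFactor h A d m) ∈ polarSpan h A := by
  have := eval_div_prod_mem_polarSpan (h := h) (B := A) (Finset.Icc (-(h : ℤ)) h) (fun _ => A)
    (fun j hj => abs_le.2 (Finset.mem_Icc.1 hj)) (fun _ _ => le_rfl)
    ((Polynomial.X - Polynomial.C (h : ℚ)) ^ d) (by
      rw [Polynomial.natDegree_pow, Polynomial.natDegree_X_sub_C, Finset.sum_const, Int.card_Icc,
        smul_eq_mul, show ((h : ℤ) + 1 - -(h : ℤ)).toNat = h + h + 1 by omega]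
      linarith)
  convert this using 2 with m
  simp only [centeredFactor, centeredPochhammer, Finset.prod_pow, Polynomial.eval_pow,
    Polynomial.eval_sub, Polynomial.eval_X, Polynomial.eval_C]

theorem centeredSummand_eq_sum (m : Fin p → ℤ) :
    centeredSummand h A P m =
      ∑ d ∈ P.support, P.coeff d * ∏ i, centeredFactor h A (d i) (m i) := by
  rw [centeredSummand, MvPolynomial.eval_eq', Finset.sum_div]
  refine Finset.sum_congr rfl fun d _ => ?_
  simp only [centeredFactor]
  rw [Finset.prod_div_distrib, mul_div_assoc]

/-- The summand equals its signed average over the `2 ^ p` sign changes, and this average turns each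
product of factors into the product of their odd parts. -/
theorem centeredSummand_eq_sum_odd (hP : P ∈ symmetryClass (h + h) A p) (m : Fin p → ℤ) :
    centeredSummand h A P m = ∑ d ∈ P.support, P.coeff d *
      ∏ i, (centeredFactor h A (d i) (m i) - centeredFactor h A (d i) (-m i)) / 2 := by
  have h1 (d : Fin p →₀ ℕ) :
      ∏ i, (centeredFactor h A (d i) (m i) - centeredFactor h A (d i) (-m i)) / 2 =
        (1 / 2 ^ p) * ∑ S ∈ Finset.univ.powerset, (-1) ^ S.card *
          ∏ i, centeredFactor h A (d i) (if i ∈ S then -m i else m i) := by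
    rw [Finset.prod_div_distrib, Finset.prod_const, Finset.card_univ, Fintype.card_fin,
      div_eq_inv_mul, one_div]
    congr 1
    rw [Finset.prod_congr rfl fun i _ => sub_eq_neg_add _ _, Finset.prod_add]
    refine Finset.sum_congr rfl fun S _ => ?_
    rw [← Finset.prod_mul_prod_compl S, ← mul_assoc, Finset.compl_eq_univ_sdiff]
    congr 1
    · rw [Finset.prod_neg]
      congr 1
      exact Finset.prod_congr rfl fun i hi => by rw [if_pos hi]
    · exact Finset.prod_congr rfl fun i hi => by rw [if_neg (Finset.mem_sdiff.1 hi).2]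
  simp only [h1, Finset.mul_sum]
  rw [Finset.sum_comm]
  have h2 : ∀ S ∈ (Finset.univ : Finset (Fin p)).powerset, ∑ d ∈ P.support, P.coeff d *
      (1 / 2 ^ p * ((-1) ^ S.card *
        ∏ i, centeredFactor h A (d i) (if i ∈ S then -m i else m i))) =
      1 / 2 ^ p * centeredSummand h A P m := by
    intro S _
    have h3 := centeredSummand_neg_on hP S m
    rw [centeredSummand_eq_sum] at h3
    have h4 : ((-1 : ℚ) ^ S.card) * (-1) ^ S.card = 1 := by rw [← mul_pow]; norm_num
    calc _ = 1 / 2 ^ p * ((-1) ^ S.card * ∑ d ∈ P.support, P.coeff d *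
          ∏ i, centeredFactor h A (d i) (if i ∈ S then -m i else m i)) := by
          rw [Finset.mul_sum, Finset.mul_sum]
          exact Finset.sum_congr rfl fun d _ => by ring
      _ = _ := by rw [h3, ← mul_assoc ((-1) ^ S.card), h4, one_mul]
  rw [Finset.sum_congr rfl h2, Finset.sum_const, Finset.card_powerset, Finset.card_univ,
    Fintype.card_fin, nsmul_eq_mul]
  push_cast
  field_simp

/-- On tuples of naturals larger than `h`, the summand is a combination of determinants. -/
theorem centeredSummand_eq_sum_det (hP : P ∈ symmetryClass (h + h) A p) (m : Fin p → ℕ)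
    (hm : ∀ i, h < m i) :
    centeredSummand h A P (fun i => (m i : ℤ)) = ∑ d ∈ P.support, P.coeff d / (p.factorial : ℚ) *
      (Matrix.of fun i j => oddTrunc h (fun x : Outer h => centeredFactor h A (d i) x) (m j)).det := by
  have h0 (d i : ℕ) (hi : h < i) : oddTrunc h (fun x : Outer h => centeredFactor h A d x) i =
      (centeredFactor h A d i - centeredFactor h A d (-i)) / 2 := by
    simp [oddTrunc, hi]
  have h1 (σ : Equiv.Perm (Fin p)) : ((Equiv.Perm.sign σ : ℤ) : ℚ) *
      (∑ d ∈ P.support, P.coeff d *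
        ∏ i, oddTrunc h (fun x : Outer h => centeredFactor h A (d i) x) (m (σ i))) =
      centeredSummand h A P (fun i => (m i : ℤ)) := by
    have h2 := centeredSummand_perm hP σ fun i => (m i : ℤ)
    rw [centeredSummand_eq_sum_odd hP] at h2
    simp only [h0 _ _ (hm _)]
    simp only [Function.comp_apply] at h2
    rw [h2, ← mul_assoc]
    norm_cast
    simp
  -- Averaging over permutations with signs leaves an antisymmetric function unchanged and makes
  -- each monomial a determinant.
  have h3 : (p.factorial : ℚ) * centeredSummand h A P (fun i => (m i : ℤ)) =
      ∑ σ : Equiv.Perm (Fin p), ((Equiv.Perm.sign σ : ℤ) : ℚ) * (∑ d ∈ P.support, P.coeff d *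
        ∏ i, oddTrunc h (fun x : Outer h => centeredFactor h A (d i) x) (m (σ i))) := by
    rw [Finset.sum_congr rfl fun σ _ => h1 σ, Finset.sum_const, Finset.card_univ,
      Fintype.card_perm, Fintype.card_fin, nsmul_eq_mul]
  have h4 : (p.factorial : ℚ) ≠ 0 := by exact_mod_cast p.factorial_ne_zero
  rw [← mul_right_inj' h4, h3, Finset.mul_sum]
  simp only [Finset.mul_sum]
  rw [Finset.sum_comm]
  refine Finset.sum_congr rfl fun d _ => ?_
  rw [← Matrix.det_transpose, Matrix.det_apply', ← mul_assoc, mul_div_cancel₀ _ h4, Finset.mul_sum]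
  refine Finset.sum_congr rfl fun σ _ => ?_
  simp only [Matrix.transpose_apply, Matrix.of_apply]
  ring

/-! ### From the hypergeometric sum to the chain form. -/

/-- At a tuple with two equal entries, the transposition of their positions fixes the tuple and
changes the sign of the summand, which is therefore `0`. -/
theorem truncatedHypergeometricSum_eq_sum_strictChains (hP : P ∈ symmetryClass (h + h) A p)
    (N : ℕ) : truncatedHypergeometricSum (h + h) A P N =
      ((∑ k ∈ strictChains p N, centeredSummand h A P (fun i => ((k i + h : ℕ) : ℤ)) : ℚ) : ℝ) := by
  have h1 (k : Fin p → ℕ) : MvPolynomial.aeval (fun i => (k i : ℝ)) P /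
      ∏ i, (ascPochhammer ℝ (h + h + 1)).eval (k i : ℝ) ^ A =
        ((centeredSummand h A P (fun i => ((k i + h : ℕ) : ℤ)) : ℚ) : ℝ) := by
    have h2 := MvPolynomial.aeval_algebraMap_apply ℝ (fun i => (k i : ℚ)) P
    simp only [eq_ratCast, Function.comp_def, Rat.cast_natCast] at h2
    simp only [h2, ascPochhammer_eval_eq_centeredPochhammer, centeredSummand]
    push_cast
    simp
  rw [truncatedHypergeometricSum, Rat.cast_sum]
  simp only [h1]
  symm
  refine Finset.sum_subset (fun k hk => ?_) fun k hk hk' => ?_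
  · rw [mem_strictChains] at hk
    rw [Finset.mem_filter, Fintype.mem_piFinset]
    refine ⟨fun i => Finset.mem_Icc.2 (hk.1 i), fun i j hij => ?_⟩
    rcases hij.eq_or_lt with rfl | hlt
    · exact le_rfl
    · exact (hk.2 i j hlt).le
  · rw [Finset.mem_filter, Fintype.mem_piFinset] at hk
    obtain ⟨i, j, hij, hk3⟩ : ∃ i j, i < j ∧ ¬ k j < k i := by
      by_contra! hc
      exact hk' (mem_strictChains.2 ⟨fun i => Finset.mem_Icc.1 (hk.1 i), hc⟩)
    have hkij : k i = k j := le_antisymm (not_lt.1 hk3) (hk.2 i j hij.le)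
    have h2 := centeredSummand_perm hP (Equiv.swap i j) fun i => ((k i + h : ℕ) : ℤ)
    have h3 : (fun i => ((k i + h : ℕ) : ℤ)) ∘ (Equiv.swap i j) =
        fun i => ((k i + h : ℕ) : ℤ) := by
      funext l
      rcases eq_or_ne l i with rfl | hli
      · simp [hkij]
      · rcases eq_or_ne l j with rfl | hlj
        · simp [hkij]
        · simp [Equiv.swap_apply_of_ne_of_ne hli hlj]
    rw [h3, Equiv.Perm.sign_swap hij.ne] at h2
    have h4 : centeredSummand h A P (fun i => ((k i + h : ℕ) : ℤ)) = 0 := by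
      push_cast at h2 ⊢
      linarith
    rw [h4, Rat.cast_zero]

/-- Translation by `h` reaches exactly the chains with all entries above `h`; on the others `G`
vanishes. This is why odd parts are truncated to `0` for `m ≤ h`. -/
theorem sum_strictChains_add (N : ℕ) (G : (Fin p → ℕ) → ℚ) (hG : ∀ m i, m i ≤ h → G m = 0) :
    ∑ k ∈ strictChains p N, G (fun i => k i + h) = ∑ m ∈ strictChains p (N + h), G m := by
  rw [← Finset.sum_filter_of_ne (s := strictChains p (N + h)) (p := fun m => ∀ i, h < m i)
    fun m _ hm i => by
      by_contra! hc
      exact hm (hG m i hc)]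
  refine Finset.sum_nbij' (fun k i => k i + h) (fun m i => m i - h) ?_ ?_ ?_ ?_ ?_
  · intro k hk
    rw [mem_strictChains] at hk
    rw [Finset.mem_filter, mem_strictChains]
    refine ⟨⟨fun i => ?_, fun i j hij => ?_⟩, fun i => ?_⟩
    · have := hk.1 i; omega
    · have := hk.2 i j hij; omega
    · have := hk.1 i; simp only; omega
  · intro m hm
    rw [Finset.mem_filter, mem_strictChains] at hm
    rw [mem_strictChains]
    refine ⟨fun i => ?_, fun i j hij => ?_⟩
    · have := hm.1.1 i; have := hm.2 i; omega
    · have := hm.1.2 i j hij; have := hm.2 j; omega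
  · intro k _; simp
  · intro m hm
    have := (Finset.mem_filter.1 hm).2
    funext i
    have := this i
    simp only
    omega
  · intro k _; rfl

theorem truncatedHypergeometricSum_eq_chainForm (hP : P ∈ symmetryClass (h + h) A p) (N : ℕ) :
    truncatedHypergeometricSum (h + h) A P N = ∑ d ∈ P.support,
      ((P.coeff d / (p.factorial : ℚ) : ℚ) : ℝ) * ((chainForm (N + h)
        (ExteriorAlgebra.ιMulti ℚ p fun i =>
          oddTrunc h (fun x : Outer h => centeredFactor h A (d i) x)) : ℚ) : ℝ) := by
  rw [truncatedHypergeometricSum_eq_sum_strictChains hP, Finset.sum_congr rfl fun k hk =>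
    centeredSummand_eq_sum_det hP (fun i => k i + h) fun i => by
      have := (mem_strictChains.1 hk).1 i; omega]
  rw [Finset.sum_comm]
  simp only [chainForm_ιMulti, ← Rat.cast_mul, ← Rat.cast_sum]
  congr 1
  refine Finset.sum_congr rfl fun d _ => ?_
  rw [← Finset.mul_sum]
  congr 1
  refine sum_strictChains_add N (fun m => (Matrix.of fun i j =>
    oddTrunc h (fun x : Outer h => centeredFactor h A (d i) x) (m j)).det) fun m j hm => ?_
  refine Matrix.det_eq_zero_of_column_eq_zero j fun i => ?_
  simp [oddTrunc, not_lt.2 hm]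

end Symmetry

theorem mainTheorem3 (n A p : ℕ) (hn : Even n) (hA : 1 ≤ A) (hp : 1 ≤ p)
    (P : MvPolynomial (Fin p) ℚ) (hP : P ∈ symmetryClass n A p)
    (hdeg : ∀ j : Fin p, MvPolynomial.degreeOf j P ≤ A * (n + 1) - 1) :
    ∃ Q : Polynomial ℝ,
      IsHarmonicExpansion (truncatedHypergeometricSum n A P) Q ∧
      Q.eval 0 ∈ Submodule.span ℚ (admissibleProducts A p) := by
  obtain ⟨h, rfl⟩ := hn
  have h1 : HasRegValueIn (Submodule.span ℚ (admissibleProducts A p))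
      (truncatedHypergeometricSum (h + h) A P) := by
    refine (HasRegValueIn.sum P.support fun d hd => HasRegValueIn.const_mul
      (P.coeff d / (p.factorial : ℚ)) ((hasRegValueIn_chainForm_oddTrunc _ fun i =>
        centeredFactor_mem_polarSpan (h := h) (A := A) (d := d i) ?_).shift h)).congr fun N =>
          (truncatedHypergeometricSum_eq_chainForm hP N).symm
    have h2 := (MvPolynomial.degreeOf_le_iff.1 (hdeg i)) d hd
    -- Positivity makes the natural subtraction in the degree bound genuine, so the bound is strict.
    have h3 : 1 ≤ A * (h + h + 1) := Nat.mul_pos hA (by omega)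
    omega
  obtain ⟨c, hc, Q, hQ, rfl⟩ := h1
  exact ⟨Q, hQ, hc⟩
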